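/- Let $\mathbb{D}$ be the open unit disc, $dA(z)=\pi^{-1}\,dx\,dy$ for $z=x+iy$, and let $\operatorname{Aut}(\mathbb{D})$ be the set of one-to-one analytic maps of $\mathbb{D}$ onto itself. Let $H^\infty$ be the space of bounded analytic functions on $\mathbb{D}$ with $\|f\|_\infty=\sup_{z\in\mathbb{D}}|f(z)|$. For a positive Borel measure $\mu$ on $\mathbb{D}$ put $$U_\mu(z)=\int_{\mathbb{D}}\log\left|\frac{1-\overline{w}z}{z-w}\right|^{2}d\mu(w)\in[0,\infty],\qquad z\in\mathbb{D},$$ where the integrand is $+\infty$ at $w=z$, and let $M(\mathcal{D}_\mu)$ be the space of analytic functions $f$ on $\mathbb{D}$ with $$\|f\|_{M(\mathcal{D}_\mu)}=|f(0)|+\sup_{\phi\in\operatorname{Aut}(\mathbb{D})}\left(\int_{\mathbb{D}}|f'(w)|^{2}\,U_\mu(\phi(w))\,dA(w)\right)^{1/2}<\infty .$$ The Hilbert matrix operator is defined, for $f(z)=\sum_{k\ge 0}a_kz^k$ in $H^\infty$, by $$\mathcal{H}(f)(z)=\sum_{n=0}^{\infty}\left(\sum_{k=0}^{\infty}\frac{a_k}{k+n+1}\right)z^{n},\qquad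 z\in\mathbb{D}.$$ **Theorem 1.3.** Let $\mu$ be a positive Borel measure on $\mathbb{D}$ that is radial, i.e. invariant under every rotation $z\mapsto\lambda z$ with $|\lambda|=1$. If $\mathcal{H}$ is bounded from $H^\infty$ into $M(\mathcal{D}_\mu)$, then its operator norm $\|\mathcal{H}\|_{H^\infty\to M(\mathcal{D}_\mu)}=\sup\{\|\mathcal{H}(f)\|_{M(\mathcal{D}_\mu)}: f\in H^\infty,\ \|f\|_\infty\le 1\}$, which is finite, is $$\|\mathcal{H}\|_{H^\infty\to M(\mathcal{D}_\mu)}=1+\left(\int_{\mathbb{D}}\frac{4}{|1-z^{2}|^{2}}\,U_\mu(z)\,dA(z)\right)^{1/2}.$$ -/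

import Mathlib

namespace HilbertMDmu

open MeasureTheory
open scoped ENNReal ComplexConjugate

noncomputable section

/-- The open unit disc of the complex plane. -/
abbrev disc : Set ℂ := Metric.ball (0 : ℂ) 1

/-- The normalized area measure `dA = π⁻¹ dx dy` on the unit disc. -/
def areaMeasure : Measure ℂ :=
  (ENNReal.ofReal Real.pi)⁻¹ • (volume : Measure ℂ).restrict disc

/-- The automorphisms of the unit disc: the one-to-one analytic maps of the disc onto itself
(values outside the disc play no role). -/
def discAut : Set (ℂ → ℂ) :=
  {φ | DifferentiableOn ℂ φ disc ∧ Set.BijOn φ disc disc}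

/-- The supremum norm `sup_{|z| < 1} |f z|`, with value `∞` for unbounded functions. -/
def hInfNorm (f : ℂ → ℂ) : ℝ≥0∞ := ⨆ z ∈ disc, ‖f z‖ₑ

/-- The Hardy space of bounded analytic functions on the disc. -/
def HInf : Set (ℂ → ℂ) := {f | DifferentiableOn ℂ f disc ∧ hInfNorm f < ∞}

/-- The kernel `log |(1 - conj w * z) / (z - w)| ^ 2`, with value `∞` on the diagonal.
On the disc it is nonnegative. -/
def greenKernel (z w : ℂ) : ℝ≥0∞ :=
  open Classical in
  if z = w then ∞ else ENNReal.ofReal (Real.log (‖(1 - conj w * z) / (z - w)‖ ^ 2))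

/-- The superharmonic function `U_μ`. -/
def potential (μ : Measure ℂ) (z : ℂ) : ℝ≥0∞ := ∫⁻ w in disc, greenKernel z w ∂μ

/-- The norm of `M(D_μ)`, with value `∞` for functions that do not belong to the space. -/
def mdNorm (μ : Measure ℂ) (f : ℂ → ℂ) : ℝ≥0∞ :=
  ‖f 0‖ₑ +
    ⨆ φ ∈ discAut, (∫⁻ w, ‖deriv f w‖ₑ ^ 2 * potential μ (φ w) ∂areaMeasure) ^ (1 / 2 : ℝ)

/-- The Möbius invariant space `M(D_μ)` generated by the Dirichlet space of `μ`. -/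
def MD (μ : Measure ℂ) : Set (ℂ → ℂ) := {f | DifferentiableOn ℂ f disc ∧ mdNorm μ f < ∞}

/-- The `k`-th Taylor coefficient at the origin. -/
def taylorCoeff (f : ℂ → ℂ) (k : ℕ) : ℂ := iteratedDeriv k f 0 / (k.factorial : ℂ)

/-- The Hilbert matrix operator
`H f z = ∑ₙ (∑ₖ aₖ / (k + n + 1)) zⁿ`, where `aₖ` are the Taylor coefficients of `f`.
Both series converge absolutely when `f` is bounded analytic and `|z| < 1`. -/
def hilbertOp (f : ℂ → ℂ) (z : ℂ) : ℂ :=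
  ∑' n : ℕ, (∑' k : ℕ, taylorCoeff f k / ((k : ℂ) + (n : ℂ) + 1)) * z ^ n

/-- The Hilbert matrix operator is a bounded operator from `H^∞` into `M(D_μ)`. -/
def HilbertBounded (μ : Measure ℂ) : Prop :=
  (∀ f ∈ HInf, hilbertOp f ∈ MD μ) ∧
    ∃ C : NNReal, ∀ f ∈ HInf, mdNorm μ (hilbertOp f) ≤ (C : ℝ≥0∞) * hInfNorm f

/-- The operator norm of the Hilbert matrix operator from `H^∞` into `M(D_μ)`: the supremum of
`‖H f‖` over the closed unit ball of `H^∞`. -/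
def hilbertOpNorm (μ : Measure ℂ) : ℝ≥0∞ :=
  ⨆ f ∈ {f | f ∈ HInf ∧ hInfNorm f ≤ 1}, mdNorm μ (hilbertOp f)

/-- `μ` is radial: invariant under all rotations about the origin. -/
def IsRadial (μ : Measure ℂ) : Prop :=
  ∀ c : ℂ, ‖c‖ = 1 → μ.map (fun z => c * z) = μ

end

end HilbertMDmu

namespace HilbertMDmu

open MeasureTheory Filter Topology Set
open scoped ENNReal ComplexConjugate

/-! The upper bound rests on an estimate for `(Hf)'` that no longer sees `f`. Writing `(Hf)'(z) =
∫₀¹ t f(t) / (1 - tz)² dt` and moving the segment to the path `hilbertPath z`, along which `dt / (1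
- tz)²` becomes `ds / (1 - z)`, gives `|(Hf)'(z)| ≤ ‖f‖∞ / |1 - z|` (`norm_deriv_hilbertOp_le`).

By the Schwarz lemma, an automorphism `φ` becomes norm preserving after composition with some Möbius
map `ψ = discMobius a`. Substituting `w = ψ(z)` and using that the potential is radial, the integral
is at most that of `|ψ'/(1 - ψ)|² U_μ`. Here `ψ'/(1 - ψ)` has the form `(l - d) / ((1 - lz)(1 -
dz))` with `|l| = 1` and `|d| ≤ 1`, so its Taylor coefficients are `l^(n+1) - d^(n+1)`. Parseval on
each circle shows that the mean square is largest for `l = 1`, `d = -1`, where the kernel is `2 / (1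
- z²)` (`integral_sq_norm_kernel_le`). A radial weight sees only these means.

For the lower bound take `f = 1`: then `H1(0) = 1` and `(1 - z)(H1)'(z) → 1` as `z → 1`. Along `ψ =
discMobius r` with `r → 1` the integrands converge pointwise to the extremal one, and Fatou's lemma
concludes (`lintegral_le_iSup_discAut`). -/

/-! ### Mean squares of the kernels on circles -/

/-- **Parseval's identity** for absolutely summable power series on the unit circle. -/
theorem integral_sq_norm_tsum_circleMap {c : ℕ → ℂ} (hc : Summable fun n => ‖c n‖) :
    ∫ θ in (0 : ℝ)..2 * Real.pi, ‖∑' n, c n * circleMap 0 1 θ ^ n‖ ^ 2 =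
      2 * Real.pi * ∑' n, ‖c n‖ ^ 2 := by
  have hterm : ∀ θ : ℝ, ∀ n, ‖c n * circleMap 0 1 θ ^ n‖ = ‖c n‖ := by
    intro θ n; simp
  have hpoly : ∀ N : ℕ, ∫ θ in (0 : ℝ)..2 * Real.pi,
      ‖∑ n ∈ Finset.range N, c n * circleMap 0 1 θ ^ n‖ ^ 2 =
      2 * Real.pi * ∑ n ∈ Finset.range N, ‖c n‖ ^ 2 := by
    intro N
    have h := Polynomial.sum_sq_norm_coeff_eq_circleAverage
      (p := ∑ n ∈ Finset.range N, Polynomial.monomial n (c n))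
    have hcoeff : ∀ m, (∑ n ∈ Finset.range N, Polynomial.monomial n (c n)).coeff m =
        if m ∈ Finset.range N then c m else 0 := by
      intro m
      simp [Polynomial.coeff_monomial]
    rw [Finset.sum_subset (s₂ := Finset.range N)] at h
    · rw [Finset.sum_congr rfl (g := fun n => ‖c n‖ ^ 2) (by
        intro m hm; rw [hcoeff, if_pos hm])] at h
      rw [h, Real.circleAverage_def, smul_eq_mul, ← mul_assoc,
        mul_inv_cancel₀ (by positivity), one_mul]
      simp [Polynomial.eval_finsetSum]
    · intro m hm
      rw [Polynomial.mem_support_iff, hcoeff] at hm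
      by_contra h2
      rw [if_neg h2] at hm
      exact hm rfl
    · intro m _ hm
      rw [Polynomial.notMem_support_iff] at hm
      simp [hm]
  have hsq : Summable fun n => ‖c n‖ ^ 2 := by
    refine Summable.of_norm_bounded_eventually_nat hc ?_
    filter_upwards [hc.tendsto_atTop_zero.eventually (ge_mem_nhds zero_lt_one)] with n hn
    rw [norm_pow, norm_norm, sq]
    exact mul_le_of_le_one_left (norm_nonneg _) hn
  have h1 : Tendsto (fun N => 2 * Real.pi * ∑ n ∈ Finset.range N, ‖c n‖ ^ 2) atTop
      (𝓝 (2 * Real.pi * ∑' n, ‖c n‖ ^ 2)) := hsq.hasSum.tendsto_sum_nat.const_mul _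
  have h2 : Tendsto (fun N => ∫ θ in (0 : ℝ)..2 * Real.pi,
      ‖∑ n ∈ Finset.range N, c n * circleMap 0 1 θ ^ n‖ ^ 2) atTop
      (𝓝 (∫ θ in (0 : ℝ)..2 * Real.pi, ‖∑' n, c n * circleMap 0 1 θ ^ n‖ ^ 2)) := by
    refine intervalIntegral.tendsto_integral_filter_of_dominated_convergence
      (fun _ => (∑' n, ‖c n‖) ^ 2) ?_ ?_ (by simp) ?_
    · exact Eventually.of_forall fun N => Continuous.aestronglyMeasurable (by fun_prop)
    · refine Eventually.of_forall fun N => Eventually.of_forall fun θ _ => ?_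
      rw [norm_pow, norm_norm]
      gcongr
      refine (norm_sum_le _ _).trans ?_
      simp only [hterm]
      exact hc.sum_le_tsum _ (fun _ _ => norm_nonneg _)
    · refine Eventually.of_forall fun θ _ => ?_
      have : Summable fun n => c n * circleMap 0 1 θ ^ n :=
        Summable.of_norm (by simpa only [hterm] using hc)
      exact (this.hasSum.tendsto_sum_nat.norm).pow 2
  refine tendsto_nhds_unique h2 ?_
  simpa only [hpoly] using h1

/-- The power series coefficients of `(l - d) / ((1 - l z) (1 - d z))`. -/
theorem hasSum_sub_pow_mul_pow {l d z : ℂ} (hl : ‖l‖ ≤ 1) (hd : ‖d‖ ≤ 1) (hz : ‖z‖ < 1) :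
    HasSum (fun n : ℕ => (l ^ (n + 1) - d ^ (n + 1)) * z ^ n)
      ((l - d) / ((1 - l * z) * (1 - d * z))) := by
  have hlz : ‖l * z‖ < 1 := by
    rw [norm_mul]; exact (mul_le_of_le_one_left (norm_nonneg _) hl).trans_lt hz
  have hdz : ‖d * z‖ < 1 := by
    rw [norm_mul]; exact (mul_le_of_le_one_left (norm_nonneg _) hd).trans_lt hz
  have h := ((hasSum_geometric_of_norm_lt_one hlz).mul_left l).sub
    ((hasSum_geometric_of_norm_lt_one hdz).mul_left d)
  have hl0 : 1 - l * z ≠ 0 := sub_ne_zero.2 fun h => by simp [← h] at hlz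
  have hd0 : 1 - d * z ≠ 0 := sub_ne_zero.2 fun h => by simp [← h] at hdz
  convert! h using 1
  · ext n; ring
  · field_simp
    ring

/-- The weighted sum `∑ |l ^ (n+1) - d ^ (n+1)| ^ 2 ρ ^ n` in closed form. -/
theorem hasSum_sq_norm_sub_pow {l d : ℂ} {ρ : ℝ} (hl : ‖l‖ = 1) (hd : ‖d‖ ≤ 1) (h0 : 0 ≤ ρ)
    (h1 : ρ < 1) :
    HasSum (fun n : ℕ => ‖l ^ (n + 1) - d ^ (n + 1)‖ ^ 2 * ρ ^ n)
      (1 / (1 - ρ) + ‖d‖ ^ 2 / (1 - ‖d‖ ^ 2 * ρ) -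
        2 * ((conj l * d) / (1 - conj l * d * ρ)).re) := by
  have hd2 : ‖d‖ ^ 2 ≤ 1 := pow_le_one₀ (norm_nonneg _) hd
  have e1 := hasSum_geometric_of_lt_one h0 h1
  have e2 := (hasSum_geometric_of_lt_one (r := ‖d‖ ^ 2 * ρ) (by positivity)
    ((mul_le_of_le_one_left h0 hd2).trans_lt h1)).mul_left (‖d‖ ^ 2)
  have hc : ‖conj l * d * ρ‖ < 1 := by
    rw [norm_mul, norm_mul, RCLike.norm_conj, hl, one_mul, Complex.norm_real, Real.norm_of_nonneg h0]
    exact (mul_le_of_le_one_left h0 hd).trans_lt h1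
  have e3 := Complex.hasSum_re ((hasSum_geometric_of_norm_lt_one hc).mul_left (conj l * d))
  convert! (e1.add e2).sub (e3.mul_left 2) using 1
  · ext n
    have : ‖l ^ (n + 1) - d ^ (n + 1)‖ ^ 2 = 1 + (‖d‖ ^ 2) ^ (n + 1) - 2 * ((conj l * d) ^ (n + 1)).re := by
      rw [← Complex.normSq_eq_norm_sq, Complex.normSq_sub, Complex.normSq_eq_norm_sq,
        Complex.normSq_eq_norm_sq, norm_pow, norm_pow, hl, mul_pow (conj l) d (n + 1), ← Complex.conj_re]
      simp only [map_mul, map_pow, Complex.conj_conj]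
      ring
    rw [this, mul_pow (conj l * d) (ρ : ℂ) n, ← mul_assoc, ← pow_succ', ← Complex.ofReal_pow,
      Complex.re_mul_ofReal]
    ring
  · ring_nf

/-- The map `c ↦ c / (1 - cρ)` sends the closed unit disc to a disc symmetric about the real axis,
whose leftmost point is the image of `c = -1`. -/
theorem re_div_one_sub_mul_ge {c : ℂ} {ρ : ℝ} (hc : ‖c‖ ≤ 1) (h0 : 0 ≤ ρ) (h1 : ρ < 1) :
    -(1 / (1 + ρ)) ≤ (c / (1 - c * ρ)).re := by
  have hne : 1 - c * ρ ≠ 0 := by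
    refine sub_ne_zero.2 fun h => ?_
    have : ‖c * ρ‖ < 1 := by
      rw [norm_mul, Complex.norm_real, Real.norm_of_nonneg h0]
      exact (mul_le_of_le_one_left h0 hc).trans_lt h1
    simp [← h] at this
  have hsq : c.re ^ 2 + c.im ^ 2 ≤ 1 := by
    have := pow_le_one₀ (norm_nonneg c) hc (n := 2)
    rw [← Complex.normSq_eq_norm_sq, Complex.normSq_apply] at this
    linarith
  have hre : -1 ≤ c.re := by
    have := Complex.abs_re_le_norm c
    linarith [neg_abs_le c.re]
  have hN : 0 < (1 - c.re * ρ) ^ 2 + (c.im * ρ) ^ 2 := by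
    have := Complex.normSq_pos.2 hne
    rw [Complex.normSq_apply] at this
    simp at this
    nlinarith
  have : (c / (1 - c * ρ)).re =
      (c.re - (c.re ^ 2 + c.im ^ 2) * ρ) / ((1 - c.re * ρ) ^ 2 + (c.im * ρ) ^ 2) := by
    rw [Complex.div_re, Complex.normSq_apply]
    simp
    rw [← add_div]
    congr 1 <;> ring
  rw [this, neg_le_iff_add_nonneg, div_add_div _ _ hN.ne' (by positivity)]
  refine div_nonneg ?_ (by positivity)
  -- The numerator equals `(1 - ρ)(1 + Re c) + ρ(1 - |c|²)`.
  nlinarith [mul_nonneg h0 (sub_nonneg.2 hsq), mul_nonneg (sub_nonneg.2 h1.le) (by linarith : 0 ≤ 1 + c.re)]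

/-- In the closed form, the term in `‖d‖` increases with `‖d‖`, and the cross term is most
favourable at `conj l * d = -1`. Both extremes occur together at `l = 1`, `d = -1`. -/
theorem tsum_sq_norm_sub_pow_le {l d : ℂ} {ρ : ℝ} (hl : ‖l‖ = 1) (hd : ‖d‖ ≤ 1) (h0 : 0 ≤ ρ)
    (h1 : ρ < 1) :
    ∑' n : ℕ, ‖l ^ (n + 1) - d ^ (n + 1)‖ ^ 2 * ρ ^ n ≤
      ∑' n : ℕ, ‖(1 : ℂ) ^ (n + 1) - (-1) ^ (n + 1)‖ ^ 2 * ρ ^ n := by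
  rw [(hasSum_sq_norm_sub_pow hl hd h0 h1).tsum_eq,
    (hasSum_sq_norm_sub_pow (l := 1) (d := -1) (by simp) (by simp) h0 h1).tsum_eq]
  have hcd : ‖conj l * d‖ ≤ 1 := by simpa [hl] using hd
  have key := re_div_one_sub_mul_ge hcd h0 h1
  have e : ((conj (1 : ℂ) * (-1)) / (1 - conj (1 : ℂ) * (-1) * ρ)).re = -(1 / (1 + ρ)) := by
    have : (conj (1 : ℂ) * (-1)) / (1 - conj (1 : ℂ) * (-1) * ρ) = ((-(1 / (1 + ρ)) : ℝ) : ℂ) := by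
      push_cast; simp [neg_div]
    rw [this, Complex.ofReal_re]
  rw [e]
  have hd2 : ‖d‖ ^ 2 ≤ 1 := pow_le_one₀ (norm_nonneg _) hd
  have : ‖d‖ ^ 2 / (1 - ‖d‖ ^ 2 * ρ) ≤ ‖(-1 : ℂ)‖ ^ 2 / (1 - ‖(-1 : ℂ)‖ ^ 2 * ρ) := by
    simp only [norm_neg, norm_one, one_pow, one_mul]
    have : 0 < 1 - ρ := by linarith
    gcongr
    exact mul_le_of_le_one_left h0 hd2
  linarith

/-- Among the kernels `(l - d) / ((1 - l z) (1 - d z))` with `|l| = 1` and `|d| ≤ 1`, the kernel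
`2 / (1 - z ^ 2)` has the largest mean square on every circle. -/
theorem integral_sq_norm_kernel_le {l d z : ℂ} (hl : ‖l‖ = 1) (hd : ‖d‖ ≤ 1) (hz : ‖z‖ < 1) :
    ∫ θ in (0 : ℝ)..2 * Real.pi, ‖(l - d) /
        ((1 - l * (circleMap 0 1 θ * z)) * (1 - d * (circleMap 0 1 θ * z)))‖ ^ 2 ≤
      ∫ θ in (0 : ℝ)..2 * Real.pi, ‖2 / (1 - (circleMap 0 1 θ * z) ^ 2)‖ ^ 2 := by
  have key : ∀ l d : ℂ, ‖l‖ = 1 → ‖d‖ ≤ 1 →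
      ∫ θ in (0 : ℝ)..2 * Real.pi, ‖(l - d) /
        ((1 - l * (circleMap 0 1 θ * z)) * (1 - d * (circleMap 0 1 θ * z)))‖ ^ 2 =
      2 * Real.pi * ∑' n : ℕ, ‖l ^ (n + 1) - d ^ (n + 1)‖ ^ 2 * (‖z‖ ^ 2) ^ n := by
    intro l d hl hd
    have hs : Summable fun n : ℕ => ‖(l ^ (n + 1) - d ^ (n + 1)) * z ^ n‖ := by
      refine Summable.of_nonneg_of_le (fun _ => norm_nonneg _) (fun n => ?_)
        ((summable_geometric_of_lt_one (norm_nonneg z) hz).mul_left 2)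
      rw [norm_mul, norm_pow]
      gcongr
      refine (norm_sub_le _ _).trans ?_
      rw [norm_pow, norm_pow, hl, one_pow]
      linarith [pow_le_one₀ (norm_nonneg d) hd (n := n + 1)]
    have h := integral_sq_norm_tsum_circleMap hs
    have e : ∀ n : ℕ, ‖(l ^ (n + 1) - d ^ (n + 1)) * z ^ n‖ ^ 2 =
        ‖l ^ (n + 1) - d ^ (n + 1)‖ ^ 2 * (‖z‖ ^ 2) ^ n := by
      intro n; rw [norm_mul, mul_pow, norm_pow, ← pow_mul, ← pow_mul, mul_comm n]
    simp only [e] at h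
    rw [← h]
    refine intervalIntegral.integral_congr fun θ _ => ?_
    rw [← (hasSum_sub_pow_mul_pow hl.le hd (z := circleMap 0 1 θ * z) (by simpa using hz)).tsum_eq]
    congr 3
    ext n
    ring
  have e : ∀ w : ℂ, 2 / (1 - w ^ 2) = (1 - (-1)) / ((1 - 1 * w) * (1 - (-1) * w)) := by
    intro w; ring_nf
  simp only [e]
  rw [key l d hl hd, key 1 (-1) (by simp) (by simp)]
  exact mul_le_mul_of_nonneg_left (tsum_sq_norm_sub_pow_le hl hd (by positivity) (pow_lt_one₀ (norm_nonneg _) hz two_ne_zero)) (by positivity)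

/-! ### Taylor coefficients and the integral form of the Hilbert operator -/

theorem hasSum_taylorCoeff {f : ℂ → ℂ} (hf : DifferentiableOn ℂ f disc) {z : ℂ} (hz : z ∈ disc) :
    HasSum (fun k => taylorCoeff f k * z ^ k) (f z) := by
  convert! Complex.hasSum_taylorSeries_on_ball hf hz using 1
  ext k
  simp only [taylorCoeff, sub_zero, smul_eq_mul]
  ring

theorem summable_norm_taylorCoeff_mul_pow {f : ℂ → ℂ} (hf : DifferentiableOn ℂ f disc) {r : ℝ}
    (h0 : 0 ≤ r) (h1 : r < 1) : Summable fun k => ‖taylorCoeff f k * (r : ℂ) ^ k‖ :=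
  (hasSum_taylorCoeff hf (z := r) (by simpa [abs_of_nonneg h0] using h1)).summable.norm

/-- The Taylor coefficients of a bounded analytic function are square summable. -/
theorem summable_sq_norm_taylorCoeff {f : ℂ → ℂ} {M : ℝ} (hf : DifferentiableOn ℂ f disc)
    (hM : ∀ z ∈ disc, ‖f z‖ ≤ M) : Summable fun k => ‖taylorCoeff f k‖ ^ 2 := by
  -- Parseval on the circle of radius `r` bounds the partial sums by `M ^ 2` uniformly in `r`; each
  -- finite sum is then passed to the limit `r → 1`.
  have hr : ∀ r : ℝ, 0 ≤ r → r < 1 → ∀ N, ∑ k ∈ Finset.range N, ‖taylorCoeff f k * (r : ℂ) ^ k‖ ^ 2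
      ≤ M ^ 2 := by
    intro r h0 h1 N
    have hs := summable_norm_taylorCoeff_mul_pow hf h0 h1
    have hsq : Summable fun k => ‖taylorCoeff f k * (r : ℂ) ^ k‖ ^ 2 := by
      refine Summable.of_norm_bounded_eventually_nat hs ?_
      filter_upwards [hs.tendsto_atTop_zero.eventually (ge_mem_nhds zero_lt_one)] with n hn
      rw [norm_pow, norm_norm, sq]
      exact mul_le_of_le_one_left (norm_nonneg _) hn
    refine (hsq.sum_le_tsum _ fun _ _ => by positivity).trans ?_
    have hp := integral_sq_norm_tsum_circleMap hs
    have hval : ∀ θ : ℝ, ∑' n, taylorCoeff f n * (r : ℂ) ^ n * circleMap 0 1 θ ^ n =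
        f (r * circleMap 0 1 θ) := by
      intro θ
      rw [← (hasSum_taylorCoeff hf (z := r * circleMap 0 1 θ)
        (by simpa [abs_of_nonneg h0] using h1)).tsum_eq]
      congr 1; ext n; ring
    simp only [hval] at hp
    have hle : ∫ θ in (0 : ℝ)..2 * Real.pi, ‖f (r * circleMap 0 1 θ)‖ ^ 2 ≤
        M ^ 2 * |2 * Real.pi - 0| := by
      refine (Real.le_norm_self _).trans
        (intervalIntegral.norm_integral_le_of_norm_le_const fun θ _ => ?_)
      rw [norm_pow, norm_norm]
      gcongr
      exact hM _ (by simpa [abs_of_nonneg h0] using h1)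
    rw [hp, sub_zero, abs_of_nonneg (by positivity), mul_comm] at hle
    exact le_of_mul_le_mul_right hle (by positivity)
  refine summable_of_sum_range_le (c := M ^ 2) (fun _ => by positivity) fun N => ?_
  have ht : Tendsto (fun r : ℝ => ∑ k ∈ Finset.range N, ‖taylorCoeff f k * (r : ℂ) ^ k‖ ^ 2)
      (𝓝[<] 1) (𝓝 (∑ k ∈ Finset.range N, ‖taylorCoeff f k * ((1 : ℝ) : ℂ) ^ k‖ ^ 2)) :=
    (Continuous.tendsto (by fun_prop) 1).mono_left nhdsWithin_le_nhds
  simp only [Complex.ofReal_one, one_pow, mul_one] at ht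
  refine le_of_tendsto ht ?_
  filter_upwards [Ioo_mem_nhdsLT (zero_lt_one' ℝ)] with r hr'
  exact hr r hr'.1.le hr'.2 N

/-- Both factors are square summable, and `ab ≤ a² + b²`. This absolute convergence permits termwise
integration of the moments. -/
theorem summable_norm_taylorCoeff_div {f : ℂ → ℂ} {M : ℝ} (hf : DifferentiableOn ℂ f disc)
    (hM : ∀ z ∈ disc, ‖f z‖ ≤ M) (n : ℕ) :
    Summable fun k : ℕ => ‖taylorCoeff f k‖ * (1 / ((k : ℝ) + n + 1)) := by
  have h2 : Summable fun k : ℕ => (1 / ((k : ℝ) + 1)) ^ 2 := by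
    have := (summable_nat_add_iff 1).2 (Real.summable_one_div_nat_pow.2 one_lt_two)
    simpa using this
  refine Summable.of_nonneg_of_le (fun k => by positivity) (fun k => ?_)
    ((summable_sq_norm_taylorCoeff hf hM).add h2)
  have : 1 / ((k : ℝ) + n + 1) ≤ 1 / ((k : ℝ) + 1) := by
    gcongr
    have : (0 : ℝ) ≤ n := n.cast_nonneg
    linarith
  have h3 : (0 : ℝ) ≤ 1 / ((k : ℝ) + 1) := by positivity
  calc _ ≤ ‖taylorCoeff f k‖ * (1 / ((k : ℝ) + 1)) := by gcongr
    _ ≤ _ := by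
      generalize ‖taylorCoeff f k‖ = a
      nlinarith [sq_nonneg (a - 1 / ((k : ℝ) + 1)), sq_nonneg a, sq_nonneg (1 / ((k : ℝ) + 1))]

theorem integrableOn_Ioo_of_continuousOn_of_norm_le {g : ℝ → ℂ} {C : ℝ}
    (hg : ContinuousOn g (Ioo 0 1)) (hC : ∀ t ∈ Ioo (0 : ℝ) 1, ‖g t‖ ≤ C) :
    IntegrableOn g (Ioo 0 1) :=
  IntegrableOn.of_bound (by simp) (hg.aestronglyMeasurable measurableSet_Ioo) C
    (ae_restrict_of_forall_mem measurableSet_Ioo hC)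

theorem ofReal_mem_disc {t : ℝ} (ht : t ∈ Ioo (0 : ℝ) 1) : (t : ℂ) ∈ disc := by
  simpa [abs_of_pos ht.1] using ht.2

theorem continuousOn_comp_ofReal_Ioo {f : ℂ → ℂ} (hf : DifferentiableOn ℂ f disc) :
    ContinuousOn (fun t : ℝ => f t) (Ioo 0 1) :=
  hf.continuousOn.comp Complex.continuous_ofReal.continuousOn fun _ ht => ofReal_mem_disc ht

/-- The moments of a bounded analytic function are the coefficients of its Hilbert transform. -/
theorem integral_pow_mul_eq_tsum {f : ℂ → ℂ} {M : ℝ} (hf : DifferentiableOn ℂ f disc)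
    (hM : ∀ z ∈ disc, ‖f z‖ ≤ M) (n : ℕ) :
    ∫ t in Ioo (0 : ℝ) 1, (t : ℂ) ^ n * f t =
      ∑' k : ℕ, taylorCoeff f k / ((k : ℂ) + (n : ℂ) + 1) := by
  have hmono : ∀ k : ℕ, ∫ t in Ioo (0 : ℝ) 1, t ^ (k + n) = 1 / ((k : ℝ) + n + 1) := by
    intro k
    rw [← integral_Ioc_eq_integral_Ioo, ← intervalIntegral.integral_of_le zero_le_one, integral_pow]
    simp
  have hcont : ∀ k : ℕ, Continuous fun t : ℝ => taylorCoeff f k * (t : ℂ) ^ (k + n) := by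
    intro k; fun_prop
  have hsum := hasSum_integral_of_summable_integral_norm (μ := volume.restrict (Ioo (0 : ℝ) 1))
    (F := fun (k : ℕ) (t : ℝ) => taylorCoeff f k * (t : ℂ) ^ (k + n))
    (fun k => ((hcont k).integrableOn_Icc (a := 0) (b := 1)).mono_set Ioo_subset_Icc_self) (by
      convert! summable_norm_taylorCoeff_div hf hM n using 2 with k
      rw [← hmono k, ← integral_const_mul]
      refine setIntegral_congr_fun measurableSet_Ioo fun t ht => ?_
      simp [abs_of_pos ht.1])
  have e1 : ∀ k : ℕ, ∫ t in Ioo (0 : ℝ) 1, taylorCoeff f k * (t : ℂ) ^ (k + n) =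
      taylorCoeff f k / ((k : ℂ) + (n : ℂ) + 1) := by
    intro k
    rw [integral_const_mul]
    have := congrArg (fun x : ℝ => (x : ℂ)) (hmono k)
    rw [← integral_complex_ofReal] at this
    push_cast at this
    rw [this]; ring
  simp only [e1] at hsum
  rw [hsum.tsum_eq]
  refine setIntegral_congr_fun measurableSet_Ioo fun t ht => ?_
  have := (hasSum_taylorCoeff hf (ofReal_mem_disc ht)).mul_left ((t : ℂ) ^ n)
  rw [← this.tsum_eq]
  congr 1; ext k; ring

theorem one_sub_mul_ne_zero {t z : ℂ} (ht : ‖t‖ ≤ 1) (hz : ‖z‖ < 1) : 1 - t * z ≠ 0 := by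
  refine sub_ne_zero.2 fun h => ?_
  have : ‖t * z‖ < 1 := by
    rw [norm_mul]; exact (mul_le_of_le_one_left (norm_nonneg _) ht).trans_lt hz
  simp [← h] at this

theorem one_sub_norm_le_norm_one_sub_mul {t z : ℂ} (ht : ‖t‖ ≤ 1) : 1 - ‖z‖ ≤ ‖1 - t * z‖ := by
  have h := norm_sub_norm_le (1 : ℂ) (t * z)
  rw [norm_one, norm_mul] at h
  linarith [mul_le_of_le_one_left (norm_nonneg z) ht]

/-- The integral representation of the Hilbert matrix operator. -/
theorem hilbertOp_eq_integral {f : ℂ → ℂ} {M : ℝ} (hf : DifferentiableOn ℂ f disc)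
    (hM : ∀ z ∈ disc, ‖f z‖ ≤ M) {z : ℂ} (hz : z ∈ disc) :
    hilbertOp f z = ∫ t in Ioo (0 : ℝ) 1, f t / (1 - t * z) := by
  have hz' : ‖z‖ < 1 := by simpa using hz
  have hc := continuousOn_comp_ofReal_Ioo hf
  have hb : ∀ n : ℕ, ∀ t ∈ Ioo (0 : ℝ) 1, ‖(t : ℂ) ^ n * f t * z ^ n‖ ≤ M * ‖z‖ ^ n := by
    intro n t ht
    rw [norm_mul, norm_mul, norm_pow, norm_pow, Complex.norm_real, Real.norm_of_nonneg ht.1.le]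
    gcongr
    exact (mul_le_of_le_one_left (norm_nonneg _) (pow_le_one₀ ht.1.le ht.2.le)).trans
      (hM _ (ofReal_mem_disc ht))
  have hcn : ∀ n : ℕ, ContinuousOn (fun t : ℝ => (t : ℂ) ^ n * f t * z ^ n) (Ioo 0 1) :=
    fun n => (ContinuousOn.mul (by fun_prop) hc).mul continuousOn_const
  have hint : ∀ n : ℕ, IntegrableOn (fun t : ℝ => (t : ℂ) ^ n * f t * z ^ n) (Ioo 0 1) :=
    fun n => integrableOn_Ioo_of_continuousOn_of_norm_le (hcn n) (hb n)
  have hsum := hasSum_integral_of_summable_integral_norm (μ := volume.restrict (Ioo (0 : ℝ) 1))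
    (F := fun (n : ℕ) (t : ℝ) => (t : ℂ) ^ n * f t * z ^ n) hint (by
      refine Summable.of_nonneg_of_le (fun n => by positivity) (fun n => ?_)
        ((summable_geometric_of_lt_one (norm_nonneg z) hz').mul_left M)
      have := setIntegral_mono_on (hint n).norm (integrableOn_const (C := M * ‖z‖ ^ n) (by simp))
        measurableSet_Ioo (hb n)
      simpa using this)
  have e : hilbertOp f z = ∑' n : ℕ, ∫ t in Ioo (0 : ℝ) 1, (t : ℂ) ^ n * f t * z ^ n := by
    unfold hilbertOp
    congr 1; ext n
    rw [← integral_pow_mul_eq_tsum hf hM, integral_mul_const]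
  rw [e, hsum.tsum_eq]
  refine setIntegral_congr_fun measurableSet_Ioo fun t ht => ?_
  have htz : ‖(t : ℂ) * z‖ < 1 := by
    rw [norm_mul, Complex.norm_real, Real.norm_of_nonneg ht.1.le]
    exact (mul_le_of_le_one_left (norm_nonneg _) ht.2.le).trans_lt hz'
  have := (hasSum_geometric_of_norm_lt_one htz).mul_left (f t)
  rw [div_eq_mul_inv, ← this.tsum_eq]
  congr 1; ext n; ring

theorem hasDerivAt_hilbertOp {f : ℂ → ℂ} {M : ℝ} (hf : DifferentiableOn ℂ f disc)
    (hM : ∀ z ∈ disc, ‖f z‖ ≤ M) {z : ℂ} (hz : z ∈ disc) :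
    HasDerivAt (hilbertOp f) (∫ t in Ioo (0 : ℝ) 1, t * f t / (1 - t * z) ^ 2) z := by
  have hz' : ‖z‖ < 1 := by simpa using hz
  have hM0 : 0 ≤ M := (norm_nonneg _).trans (hM 0 (by simp))
  -- Half the distance from `z` to the unit circle, so that `‖1 - t * w‖ ≥ δ` for all `w` within `δ`
  -- of `z`.
  set δ : ℝ := (1 - ‖z‖) / 2 with hδ
  have hδ0 : 0 < δ := by linarith
  have hball : ∀ w ∈ Metric.ball z δ, ‖w‖ < 1 - δ := by
    intro w hw
    have h1 : ‖w - z‖ < δ := by simpa [dist_eq_norm] using hw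
    have := norm_le_norm_add_norm_sub z w
    rw [norm_sub_rev] at h1
    linarith [norm_sub_rev z w]
  have hnt : ∀ t ∈ Ioo (0 : ℝ) 1, ‖(t : ℂ)‖ ≤ 1 := fun t ht => by
    simpa [abs_of_pos ht.1] using ht.2.le
  have hcf := continuousOn_comp_ofReal_Ioo hf
  have hc1 : ∀ w : ℂ, ‖w‖ < 1 → ContinuousOn (fun t : ℝ => f t / (1 - t * w)) (Ioo 0 1) :=
    fun w hw => hcf.div (by fun_prop) fun t ht => one_sub_mul_ne_zero (hnt t ht) hw
  have h := hasDerivAt_integral_of_dominated_loc_of_deriv_le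
    (μ := volume.restrict (Ioo (0 : ℝ) 1)) (F := fun (w : ℂ) (t : ℝ) => f t / (1 - t * w))
    (F' := fun (w : ℂ) (t : ℝ) => t * f t / (1 - t * w) ^ 2) (x₀ := z)
    (bound := fun _ => M / δ ^ 2) (Metric.ball_mem_nhds z hδ0) ?_ ?_ ?_ ?_ ?_ ?_
  · refine h.2.congr_of_eventuallyEq ?_
    filter_upwards [Metric.isOpen_ball.mem_nhds hz] with w hw
    exact hilbertOp_eq_integral hf hM hw
  · filter_upwards [Metric.ball_mem_nhds z hδ0] with w hw
    exact (hc1 w ((hball w hw).trans (by linarith))).aestronglyMeasurable measurableSet_Ioo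
  · refine integrableOn_Ioo_of_continuousOn_of_norm_le (hc1 z hz') (C := M / (1 - ‖z‖)) fun t ht => ?_
    rw [norm_div]
    have : 0 < 1 - ‖z‖ := by linarith
    gcongr
    · exact hM _ (ofReal_mem_disc ht)
    · exact one_sub_norm_le_norm_one_sub_mul (hnt t ht)
  · refine ContinuousOn.aestronglyMeasurable ?_ measurableSet_Ioo
    exact (ContinuousOn.mul (by fun_prop) hcf).div (by fun_prop)
      fun t ht => pow_ne_zero 2 (one_sub_mul_ne_zero (hnt t ht) hz')
  · refine ae_restrict_of_forall_mem measurableSet_Ioo fun t ht w hw => ?_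
    rw [norm_div, norm_mul, norm_pow]
    gcongr
    · exact (mul_le_of_le_one_left (norm_nonneg _) (hnt t ht)).trans (hM _ (ofReal_mem_disc ht))
    · linarith [one_sub_norm_le_norm_one_sub_mul (z := w) (hnt t ht), hball w hw]
  · exact integrableOn_const (by simp)
  · refine ae_restrict_of_forall_mem measurableSet_Ioo fun t ht w hw => ?_
    have hne := one_sub_mul_ne_zero (hnt t ht) ((hball w hw).trans (by linarith))
    have h1 : HasDerivAt (fun w : ℂ => 1 - (t : ℂ) * w) (-t) w := by
      simpa using ((hasDerivAt_id w).const_mul (t : ℂ)).const_sub 1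
    convert! (hasDerivAt_const w (f t)).div h1 hne using 1
    ring

/-! ### Deformation of the path and the pointwise bound on the derivative -/

/-- The path from `0` to `1` in the disc along which `dt / (1 - t z) ^ 2` has constant argument. -/
noncomputable def hilbertPath (z : ℂ) (s : ℝ) : ℂ := s / (1 - (1 - s) * z)

theorem norm_ofReal_le_one_of_mem {s : ℝ} (hs : s ∈ Icc (0 : ℝ) 1) : ‖(s : ℂ)‖ ≤ 1 := by
  simpa [abs_of_nonneg hs.1] using hs.2

theorem norm_one_sub_ofReal_le {s : ℝ} (hs : s ∈ Icc (0 : ℝ) 1) : ‖1 - (s : ℂ)‖ ≤ 1 := by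
  have := norm_ofReal_le_one_of_mem (s := 1 - s) ⟨by linarith [hs.2], by linarith [hs.1]⟩
  simpa using this

theorem hilbertPath_denom_ne_zero {z : ℂ} (hz : ‖z‖ < 1) {s : ℝ} (hs : s ∈ Icc (0 : ℝ) 1) :
    1 - (1 - (s : ℂ)) * z ≠ 0 :=
  one_sub_mul_ne_zero (norm_one_sub_ofReal_le hs) hz

/-- The denominator has modulus at least `1 - (1 - s)‖z‖`, which exceeds `s` when `s < 1`. -/
theorem hilbertPath_mem_disc {z : ℂ} (hz : ‖z‖ < 1) {s : ℝ} (hs : s ∈ Ico (0 : ℝ) 1) :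
    hilbertPath z s ∈ disc := by
  have hs' : s ∈ Icc (0 : ℝ) 1 := ⟨hs.1, hs.2.le⟩
  have hpos := norm_pos_iff.2 (hilbertPath_denom_ne_zero hz hs')
  rw [mem_ball_zero_iff, hilbertPath, norm_div, div_lt_one hpos, Complex.norm_real,
    Real.norm_of_nonneg hs.1]
  have h := norm_sub_norm_le (1 : ℂ) ((1 - (s : ℂ)) * z)
  have e : ‖1 - (s : ℂ)‖ = 1 - s := by
    rw [← Complex.ofReal_one, ← Complex.ofReal_sub, Complex.norm_real,
      Real.norm_of_nonneg (by linarith [hs.2])]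
  rw [norm_one, norm_mul, e] at h
  nlinarith [hs.2]

theorem continuousOn_hilbertPath {z : ℂ} (hz : ‖z‖ < 1) :
    ContinuousOn (hilbertPath z) (Icc 0 1) :=
  ContinuousOn.div (by fun_prop) (by fun_prop) fun _ hs => hilbertPath_denom_ne_zero hz hs

theorem hilbertPath_one (z : ℂ) : hilbertPath z 1 = 1 := by simp [hilbertPath]

theorem hasDerivAt_hilbertPath {z : ℂ} (hz : ‖z‖ < 1) {s : ℝ} (hs : s ∈ Icc (0 : ℝ) 1) :
    HasDerivAt (hilbertPath z) ((1 - z) / (1 - (1 - (s : ℂ)) * z) ^ 2) s := by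
  have h1 : HasDerivAt (fun w : ℂ => 1 - (1 - w) * z) z (s : ℂ) := by
    simpa using (((hasDerivAt_id (s : ℂ)).const_sub 1).mul_const z).const_sub 1
  have h2 := ((hasDerivAt_id (s : ℂ)).div h1 (hilbertPath_denom_ne_zero hz hs)).comp_ofReal
  convert! h2 using 1
  simp only [id]
  congr 1; ring

/-- The derivative of the Hilbert transform, after deforming the path of integration. -/
theorem integral_eq_integral_hilbertPath {f : ℂ → ℂ} {M : ℝ} (hf : DifferentiableOn ℂ f disc)
    (hM : ∀ z ∈ disc, ‖f z‖ ≤ M) {z : ℂ} (hz : z ∈ disc) :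
    ∫ t in Ioo (0 : ℝ) 1, t * f t / (1 - t * z) ^ 2 =
      ∫ s in Ioo (0 : ℝ) 1, hilbertPath z s * f (hilbertPath z s) / (1 - z) := by
  have hz' : ‖z‖ < 1 := by simpa using hz
  have hM0 : 0 ≤ M := (norm_nonneg _).trans (hM 0 (by simp))
  have h1z : 1 - z ≠ 0 := by simpa using one_sub_mul_ne_zero (t := 1) (by simp) hz'
  have hδ : 0 < 1 - ‖z‖ := by linarith
  set g : ℂ → ℂ := fun t => t * f t / (1 - t * z) ^ 2 with hg
  set h : ℝ → ℂ := fun s => hilbertPath z s * f (hilbertPath z s) / (1 - z) with hh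
  have hgd : DifferentiableOn ℂ g disc := by
    refine (DifferentiableOn.mul differentiableOn_id hf).div (by fun_prop) fun t ht => ?_
    exact pow_ne_zero 2 (one_sub_mul_ne_zero (by simpa using (mem_ball_zero_iff.1 ht).le) hz')
  -- A primitive of `g` on the disc replaces Cauchy's theorem. Since both paths end at the boundary
  -- point `1`, they are truncated at `x < 1` and compared in the limit.
  obtain ⟨K, hK⟩ := hgd.isExactOn_ball
  have hgb : ∀ t ∈ disc, ‖g t‖ ≤ M / (1 - ‖z‖) ^ 2 := by
    intro t ht
    have ht1 : ‖t‖ ≤ 1 := (mem_ball_zero_iff.1 ht).le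
    rw [hg]
    simp only [norm_div, norm_mul, norm_pow]
    gcongr
    · exact (mul_le_of_le_one_left (norm_nonneg _) ht1).trans (hM _ ht)
    · exact one_sub_norm_le_norm_one_sub_mul ht1
  have hmem : ∀ t ∈ Ico (0 : ℝ) 1, (t : ℂ) ∈ disc := fun t ht => by
    simpa [abs_of_nonneg ht.1] using ht.2
  have hgc : ContinuousOn (fun t : ℝ => g t) (Ico 0 1) :=
    hgd.continuousOn.comp Complex.continuous_ofReal.continuousOn hmem
  have hpc : ContinuousOn (hilbertPath z) (Ico 0 1) :=
    (continuousOn_hilbertPath hz').mono Ico_subset_Icc_self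
  have hhc : ContinuousOn h (Ico 0 1) :=
    (hpc.mul (hf.continuousOn.comp hpc fun s hs => hilbertPath_mem_disc hz' hs)).div_const _
  have hgi : IntegrableOn (fun t : ℝ => g t) (Ioo 0 1) :=
    integrableOn_Ioo_of_continuousOn_of_norm_le (hgc.mono Ioo_subset_Ico_self)
      fun t ht => hgb _ (ofReal_mem_disc ht)
  have hhi : IntegrableOn h (Ioo 0 1) := by
    refine integrableOn_Ioo_of_continuousOn_of_norm_le (hhc.mono Ioo_subset_Ico_self)
      (C := M / ‖1 - z‖) fun s hs => ?_
    have hd := hilbertPath_mem_disc hz' ⟨hs.1.le, hs.2⟩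
    rw [hh]
    simp only [norm_div, norm_mul]
    gcongr
    exact (mul_le_of_le_one_left (norm_nonneg _) (mem_ball_zero_iff.1 hd).le).trans (hM _ hd)
  have hA : ∀ x ∈ Ico (0 : ℝ) 1, ∫ t in (0 : ℝ)..x, g t = K x - K 0 := by
    intro x hx
    have hsub : uIcc 0 x ⊆ Ico (0 : ℝ) 1 := by
      rw [uIcc_of_le hx.1]; exact fun t ht => ⟨ht.1, ht.2.trans_lt hx.2⟩
    have := intervalIntegral.integral_eq_sub_of_hasDerivAt (a := 0) (b := x)
      (f := fun t : ℝ => K t) (f' := fun t : ℝ => g t)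
      (fun t ht => (hK _ (hmem t (hsub ht))).comp_ofReal) (hgc.mono hsub).intervalIntegrable
    simpa using this
  have hB : ∀ x ∈ Ico (0 : ℝ) 1, ∫ s in (0 : ℝ)..x, h s = K (hilbertPath z x) - K 0 := by
    intro x hx
    have hsub : uIcc 0 x ⊆ Ico (0 : ℝ) 1 := by
      rw [uIcc_of_le hx.1]; exact fun t ht => ⟨ht.1, ht.2.trans_lt hx.2⟩
    have := intervalIntegral.integral_eq_sub_of_hasDerivAt (a := 0) (b := x)
      (f := fun s : ℝ => K (hilbertPath z s)) (f' := h) (fun s hs => by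
        have hs' : s ∈ Icc (0 : ℝ) 1 := Ico_subset_Icc_self (hsub hs)
        have hne := hilbertPath_denom_ne_zero hz' hs'
        convert! (hK _ (hilbertPath_mem_disc hz' (hsub hs))).comp s (hasDerivAt_hilbertPath hz' hs')
          using 1
        -- With this identity the factor `(1 - z) / D ^ 2` of the path derivative cancels against
        -- `(1 - p z) ^ 2`, leaving `1 / (1 - z)`.
        have e : 1 - hilbertPath z s * z = (1 - z) / (1 - (1 - (s : ℂ)) * z) := by
          rw [hilbertPath]; field_simp; ring
        simp only [hh, hg]
        rw [e]
        generalize 1 - (1 - (s : ℂ)) * z = D at hne ⊢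
        field_simp) (hhc.mono hsub).intervalIntegrable
    simpa [hilbertPath] using this
  have hIcc : ∀ u : ℝ → ℂ, IntegrableOn u (Ioo 0 1) → IntegrableOn u (uIcc (0 : ℝ) 1) := by
    intro u hu
    rw [uIcc_of_le zero_le_one]
    rwa [integrableOn_Icc_iff_integrableOn_Ioo]
  have hlim : ∀ u : ℝ → ℂ, IntegrableOn u (Ioo 0 1) →
      Tendsto (fun x => ∫ t in (0 : ℝ)..x, u t) (𝓝[<] 1) (𝓝 (∫ t in Ioo (0 : ℝ) 1, u t)) := by
    intro u hu
    have h1 := intervalIntegral.continuousOn_primitive_interval (hIcc u hu) 1 right_mem_uIcc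
    rw [ContinuousWithinAt, uIcc_of_le zero_le_one, intervalIntegral.integral_of_le zero_le_one,
      integral_Ioc_eq_integral_Ioo] at h1
    refine h1.mono_left ?_
    rw [← nhdsWithin_Ioo_eq_nhdsLT (zero_lt_one' ℝ)]
    exact nhdsWithin_mono _ Ioo_subset_Icc_self
  -- The truncated integrals differ by `K x - K (hilbertPath z x)`. As `g` is bounded, `K` is
  -- Lipschitz on the convex disc, and both endpoints tend to `1`.
  have hzero : Tendsto (fun x => (∫ t in (0 : ℝ)..x, g t) - ∫ s in (0 : ℝ)..x, h s)
      (𝓝[<] 1) (𝓝 0) := by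
    have hp : Tendsto (fun x : ℝ => M / (1 - ‖z‖) ^ 2 * ‖(x : ℂ) - hilbertPath z x‖) (𝓝[<] 1)
        (𝓝 0) := by
      have hc : ContinuousWithinAt (fun x : ℝ => M / (1 - ‖z‖) ^ 2 * ‖(x : ℂ) - hilbertPath z x‖)
          (Icc 0 1) 1 :=
        (continuousWithinAt_const.mul ((Complex.continuous_ofReal.continuousWithinAt).sub
          (continuousOn_hilbertPath hz' 1 (by simp))).norm)
      rw [ContinuousWithinAt, hilbertPath_one] at hc
      simp only [Complex.ofReal_one, sub_self, norm_zero, mul_zero] at hc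
      refine hc.mono_left ?_
      rw [← nhdsWithin_Ioo_eq_nhdsLT (zero_lt_one' ℝ)]
      exact nhdsWithin_mono _ Ioo_subset_Icc_self
    refine squeeze_zero_norm' ?_ hp
    filter_upwards [Ioo_mem_nhdsLT (zero_lt_one' ℝ)] with x hx
    have hx' : x ∈ Ico (0 : ℝ) 1 := ⟨hx.1.le, hx.2⟩
    rw [hA x hx', hB x hx', sub_sub_sub_cancel_right]
    exact (convex_ball (0 : ℂ) 1).norm_image_sub_le_of_norm_hasDerivWithin_le
      (fun t ht => (hK t ht).hasDerivWithinAt) hgb (hilbertPath_mem_disc hz' hx') (hmem x hx')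
  exact sub_eq_zero.1 (tendsto_nhds_unique ((hlim _ hgi).sub (hlim _ hhi)) hzero)

theorem deriv_hilbertOp_eq {f : ℂ → ℂ} {M : ℝ} (hf : DifferentiableOn ℂ f disc)
    (hM : ∀ z ∈ disc, ‖f z‖ ≤ M) {z : ℂ} (hz : z ∈ disc) :
    deriv (hilbertOp f) z =
      (∫ s in Ioo (0 : ℝ) 1, hilbertPath z s * f (hilbertPath z s)) / (1 - z) := by
  rw [(hasDerivAt_hilbertOp hf hM hz).deriv, integral_eq_integral_hilbertPath hf hM hz,
    integral_div]

theorem norm_deriv_hilbertOp_le {f : ℂ → ℂ} {M : ℝ} (hf : DifferentiableOn ℂ f disc)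
    (hM : ∀ z ∈ disc, ‖f z‖ ≤ M) {z : ℂ} (hz : z ∈ disc) :
    ‖deriv (hilbertOp f) z‖ ≤ M / ‖1 - z‖ := by
  have hz' : ‖z‖ < 1 := by simpa using hz
  rw [deriv_hilbertOp_eq hf hM hz, norm_div]
  gcongr
  refine (norm_setIntegral_le_of_norm_le_const (C := M) (by simp) fun s hs => ?_).trans (by simp)
  have hd := hilbertPath_mem_disc hz' ⟨hs.1.le, hs.2⟩
  rw [norm_mul]
  exact (mul_le_of_le_one_left (norm_nonneg _) (mem_ball_zero_iff.1 hd).le).trans (hM _ hd)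

theorem norm_hilbertOp_zero_le {f : ℂ → ℂ} {M : ℝ} (hf : DifferentiableOn ℂ f disc)
    (hM : ∀ z ∈ disc, ‖f z‖ ≤ M) : ‖hilbertOp f 0‖ ≤ M := by
  rw [hilbertOp_eq_integral hf hM (by simp)]
  refine (norm_setIntegral_le_of_norm_le_const (C := M) (by simp) fun s hs => ?_).trans (by simp)
  simpa using hM _ (ofReal_mem_disc hs)

theorem hilbertOp_one_zero : hilbertOp 1 0 = 1 := by
  rw [hilbertOp_eq_integral (f := 1) (M := 1) (differentiableOn_const 1) (by simp) (by simp)]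
  simp

/-- For `f = 1` the bound `1 / |1 - z|` is asymptotically sharp at `1`: for each fixed `s > 0` the
path point `s / (1 - (1 - s) z)` tends to `1`, and it stays in the disc, so dominated convergence
applies. -/
theorem tendsto_one_sub_mul_deriv_hilbertOp_one :
    Tendsto (fun z => (1 - z) * deriv (hilbertOp 1) z) (𝓝[disc] 1) (𝓝 1) := by
  have h : Tendsto (fun z => ∫ s in Ioo (0 : ℝ) 1, hilbertPath z s) (𝓝[disc] 1)
      (𝓝 (∫ _ in Ioo (0 : ℝ) 1, (1 : ℂ))) := by
    refine tendsto_integral_filter_of_dominated_convergence (fun _ => 1) ?_ ?_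
      (integrableOn_const (by simp)) ?_
    · filter_upwards [self_mem_nhdsWithin] with z hz
      exact ((continuousOn_hilbertPath (mem_ball_zero_iff.1 hz)).mono
        Ioo_subset_Icc_self).aestronglyMeasurable measurableSet_Ioo
    · filter_upwards [self_mem_nhdsWithin] with z hz
      refine ae_restrict_of_forall_mem measurableSet_Ioo fun s hs => ?_
      exact (mem_ball_zero_iff.1
        (hilbertPath_mem_disc (mem_ball_zero_iff.1 hz) ⟨hs.1.le, hs.2⟩)).le
    · refine ae_restrict_of_forall_mem measurableSet_Ioo fun s hs => ?_
      have hs0 : (s : ℂ) ≠ 0 := by exact_mod_cast hs.1.ne'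
      have : ContinuousAt (fun z : ℂ => (s : ℂ) / (1 - (1 - s) * z)) 1 :=
        ContinuousAt.div (by fun_prop) (by fun_prop) (by simpa using hs0)
      have h2 := this.tendsto
      simp only [mul_one, sub_sub_cancel, div_self hs0] at h2
      exact h2.mono_left nhdsWithin_le_nhds
  simp only [integral_const, measureReal_restrict_apply_univ, Real.volume_real_Ioo, sub_zero,
    zero_le_one, sup_of_le_left, one_smul] at h
  refine h.congr' ?_
  filter_upwards [self_mem_nhdsWithin] with z hz
  have h1z : 1 - z ≠ 0 := by
    simpa using one_sub_mul_ne_zero (t := 1) (by simp) (mem_ball_zero_iff.1 hz)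
  rw [deriv_hilbertOp_eq (f := 1) (M := 1) (differentiableOn_const 1) (by simp) hz]
  simp only [Pi.one_apply, mul_one]
  field_simp

/-! ### The Green kernel and the radial potential -/

theorem sq_norm_one_sub_conj_mul_sub (z w : ℂ) :
    ‖1 - conj w * z‖ ^ 2 - ‖z - w‖ ^ 2 = (1 - ‖z‖ ^ 2) * (1 - ‖w‖ ^ 2) := by
  simp only [← Complex.normSq_eq_norm_sq, Complex.normSq_apply]
  simp
  ring

theorem greenKernel_pos {z w : ℂ} (hz : z ∈ disc) (hw : w ∈ disc) : 0 < greenKernel z w := by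
  unfold greenKernel
  split_ifs with h
  · simp
  · have hz' : ‖z‖ ^ 2 < 1 := pow_lt_one₀ (norm_nonneg _) (mem_ball_zero_iff.1 hz) two_ne_zero
    have hw' : ‖w‖ ^ 2 < 1 := pow_lt_one₀ (norm_nonneg _) (mem_ball_zero_iff.1 hw) two_ne_zero
    have hpos : 0 < ‖z - w‖ := norm_pos_iff.2 (sub_ne_zero.2 h)
    have hlt := sq_norm_one_sub_conj_mul_sub z w
    have : 0 < (1 - ‖z‖ ^ 2) * (1 - ‖w‖ ^ 2) := mul_pos (by linarith) (by linarith)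
    refine ENNReal.ofReal_pos.2 (Real.log_pos ?_)
    rw [norm_div, div_pow, one_lt_div (by positivity)]
    linarith

theorem measurable_greenKernel : Measurable fun p : ℂ × ℂ => greenKernel p.1 p.2 := by
  classical
  unfold greenKernel
  refine Measurable.ite (measurableSet_eq_fun measurable_fst measurable_snd) measurable_const ?_
  have : Measurable fun p : ℂ × ℂ => conj p.2 := Complex.continuous_conj.measurable.comp measurable_snd
  fun_prop

theorem greenKernel_mul_mul {c : ℂ} (hc : ‖c‖ = 1) (z w : ℂ) :
    greenKernel (c * z) (c * w) = greenKernel z w := by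
  have hc0 : c ≠ 0 := norm_ne_zero_iff.1 (by simp [hc])
  have hcc : conj c * c = 1 := by
    rw [← Complex.normSq_eq_conj_mul_self, Complex.normSq_eq_norm_sq, hc]; simp
  have e : 1 - conj (c * w) * (c * z) = 1 - conj w * z := by
    rw [map_mul, show conj c * conj w * (c * z) = (conj c * c) * (conj w * z) by ring, hcc, one_mul]
  simp only [greenKernel, e, mul_right_inj' hc0, ← mul_sub, norm_div, norm_mul, hc, one_mul]

theorem potential_mul {μ : Measure ℂ} (hμ : IsRadial μ) {c : ℂ} (hc : ‖c‖ = 1) (z : ℂ) :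
    potential μ (c * z) = potential μ z := by
  have hm : Measurable (greenKernel (c * z)) := measurable_greenKernel.comp measurable_prodMk_left
  have hpre : (fun w => c * w) ⁻¹' disc = disc := by ext w; simp [hc]
  unfold potential
  nth_rw 1 [← hμ c hc]
  rw [setLIntegral_map measurableSet_ball hm (by fun_prop), hpre]
  simp only [greenKernel_mul_mul hc]

theorem potential_eq_of_norm_eq {μ : Measure ℂ} (hμ : IsRadial μ) {z w : ℂ} (h : ‖z‖ = ‖w‖) :
    potential μ z = potential μ w := by
  rcases eq_or_ne w 0 with rfl | hw
  · simp at h; rw [h]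
  · rw [← potential_mul hμ (c := z / w) (by rw [norm_div, h, div_self (by simpa)]) w,
      div_mul_cancel₀ _ hw]

/-- A measure with a potential that is finite somewhere is s-finite on the disc. -/
theorem sFinite_restrict_of_potential_ne_top {μ : Measure ℂ} {z : ℂ} (hz : z ∈ disc)
    (h : potential μ z ≠ ∞) : SFinite (μ.restrict disc) := by
  have hm : Measurable (greenKernel z) := measurable_greenKernel.comp measurable_prodMk_left
  have : IsFiniteMeasure ((μ.restrict disc).withDensity (greenKernel z)) :=
    isFiniteMeasure_withDensity h
  -- The kernel is positive and almost everywhere finite, so the restricted measure is recovered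
  -- from a finite measure by the inverse density.
  rw [← withDensity_inv_same (μ := μ.restrict disc) hm
    (ae_restrict_of_forall_mem measurableSet_ball fun w hw => (greenKernel_pos hz hw).ne')
    ((ae_lt_top hm h).mono fun _ h => h.ne)]
  infer_instance

theorem measurable_potential {μ : Measure ℂ} [SFinite (μ.restrict disc)] :
    Measurable (potential μ) :=
  measurable_greenKernel.lintegral_prod_right'

/-! ### Automorphisms of the disc -/

/-- The inverse of an analytic bijection of the disc is analytic. -/
theorem differentiableOn_of_leftInverse_of_bijOn {g h : ℂ → ℂ} (hg : DifferentiableOn ℂ g disc)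
    (hb : BijOn g disc disc) (hinv : InvOn h g disc disc) : DifferentiableOn ℂ h disc := by
  have hmaps : MapsTo h disc disc := fun w hw => by
    obtain ⟨z, hz, rfl⟩ := hb.surjOn hw
    rwa [hinv.1 hz]
  have han : AnalyticOnNhd ℂ g disc := hg.analyticOnNhd Metric.isOpen_ball
  have hnc : ∀ w, ∀ U ⊆ disc, IsOpen U → U.Nonempty → ¬ ∀ z ∈ U, g z = w := by
    rintro w U hU hUo ⟨x, hx⟩ hc
    have : U ⊆ {x} := fun y hy => hb.injOn (hU hy) (hU hx) ((hc y hy).trans (hc x hx).symm)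
    have hfin : (U : Set ℂ).Finite := (finite_singleton x).subset this
    exact (infinite_of_mem_nhds x (hUo.mem_nhds hx)) hfin
  have hopen : ∀ U ⊆ disc, IsOpen U → IsOpen (g '' U) := by
    rcases han.is_constant_or_isOpen (convex_ball (0 : ℂ) 1).isPreconnected with ⟨w, hw⟩ | h
    · exact absurd hw (hnc w disc subset_rfl Metric.isOpen_ball ⟨0, by simp⟩)
    · exact h
  have hcont : ∀ w ∈ disc, ContinuousAt h w := by
    intro w hw
    rw [ContinuousAt, tendsto_nhds]
    intro V hV hwV
    have h1 := hopen (disc ∩ V) inter_subset_left (Metric.isOpen_ball.inter hV)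
    refine mem_of_superset (h1.mem_nhds ⟨h w, ⟨hmaps hw, hwV⟩, hinv.2 hw⟩) ?_
    rintro _ ⟨z, hz, rfl⟩
    rw [mem_preimage, hinv.1 hz.1]
    exact hz.2
  have hdiff : ∀ w ∈ disc, deriv g (h w) ≠ 0 → DifferentiableAt ℂ h w := by
    intro w hw hne
    refine (HasDerivAt.of_local_left_inverse (hcont w hw) (f := g) (f' := deriv g (h w)) ?_ hne
      ?_).differentiableAt
    · exact (hg.differentiableAt (Metric.isOpen_ball.mem_nhds (hmaps hw))).hasDerivAt
    · filter_upwards [Metric.isOpen_ball.mem_nhds hw] with v hv using hinv.2 hv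
  intro w hw
  -- If `deriv g` vanished near `h w`, then `g` would be locally constant, against injectivity.
  -- Otherwise the zero is at worst isolated, and the continuous `h` has a removable singularity at
  -- `w`.
  rcases (han (h w) (hmaps hw)).deriv.eventually_eq_zero_or_eventually_ne_zero with h0 | h0
  · exfalso
    obtain ⟨ε, hε, hball⟩ := Metric.mem_nhds_iff.1
      (inter_mem h0 (Metric.isOpen_ball.mem_nhds (hmaps hw)))
    refine hnc (g (h w)) (Metric.ball (h w) ε) (fun z hz => (hball hz).2) Metric.isOpen_ball
      ⟨h w, Metric.mem_ball_self hε⟩ fun z hz => ?_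
    refine (convex_ball (h w) ε).is_const_of_fderivWithin_eq_zero (𝕜 := ℂ) (f := g)
      (hg.mono fun z hz => (hball hz).2) (fun x hx => ?_) hz (Metric.mem_ball_self hε)
    rw [fderivWithin_of_isOpen Metric.isOpen_ball hx]
    ext
    simpa using (hball hx).1
  · have hpunct : ∀ᶠ v in 𝓝[≠] w, v ∈ disc ∧ DifferentiableAt ℂ h v := by
      have ht : Tendsto h (𝓝[≠] w) (𝓝[≠] (h w)) := by
        refine tendsto_nhdsWithin_iff.2 ⟨(hcont w hw).tendsto.mono_left nhdsWithin_le_nhds, ?_⟩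
        filter_upwards [self_mem_nhdsWithin,
          mem_nhdsWithin_of_mem_nhds (Metric.isOpen_ball.mem_nhds hw)] with v hv hvd heq
        exact hv (by rw [mem_singleton_iff, ← hinv.2 hvd, ← hinv.2 hw, heq])
      filter_upwards [ht.eventually h0,
        mem_nhdsWithin_of_mem_nhds (Metric.isOpen_ball.mem_nhds hw)] with v hv hvd
      exact ⟨hvd, hdiff v hvd hv⟩
    rw [eventually_nhdsWithin_iff] at hpunct
    obtain ⟨ε, hε, hball⟩ := Metric.mem_nhds_iff.1 hpunct
    have := (Complex.differentiableOn_compl_singleton_and_continuousAt_iff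
      (Metric.ball_mem_nhds w hε)).1 ⟨fun v hv =>
        ((hball hv.1) hv.2).2.differentiableWithinAt, hcont w hw⟩
    exact (this.differentiableAt (Metric.ball_mem_nhds w hε)).differentiableWithinAt

/-- The Schwarz lemma applied to `g` and to its inverse gives the two inequalities. -/
theorem norm_apply_eq_of_bijOn {g : ℂ → ℂ} (hg : DifferentiableOn ℂ g disc)
    (hb : BijOn g disc disc) (h0 : g 0 = 0) {z : ℂ} (hz : z ∈ disc) : ‖g z‖ = ‖z‖ := by
  have hinv := hb.invOn_invFunOn
  set h := Function.invFunOn g disc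
  have hh := differentiableOn_of_leftInverse_of_bijOn hg hb hinv
  have hmaps : MapsTo h disc disc := hb.surjOn.mapsTo_invFunOn
  have hh0 : h 0 = 0 := by
    have := hinv.1 (show (0 : ℂ) ∈ disc by simp)
    rwa [h0] at this
  refine le_antisymm ?_ ?_
  · exact Complex.norm_le_norm_of_mapsTo_ball hg (hb.mapsTo.mono_right Metric.ball_subset_closedBall)
      h0 (mem_ball_zero_iff.1 hz)
  · have := Complex.norm_le_norm_of_mapsTo_ball hh (hmaps.mono_right Metric.ball_subset_closedBall)
      hh0 (mem_ball_zero_iff.1 (hb.mapsTo hz))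
    rwa [hinv.1 hz] at this

/-- The automorphism of the disc that maps `0` to `a`. -/
noncomputable def discMobius (a z : ℂ) : ℂ := (z + a) / (1 + conj a * z)

theorem discMobius_denom_ne_zero {a z : ℂ} (ha : ‖a‖ ≤ 1) (hz : ‖z‖ < 1) : 1 + conj a * z ≠ 0 := by
  simpa using one_sub_mul_ne_zero (t := -conj a) (by simpa) hz

theorem one_sub_conj_mul_self_ne_zero {a : ℂ} (ha : ‖a‖ < 1) : 1 - conj a * a ≠ 0 :=
  one_sub_mul_ne_zero (by simpa using ha.le) ha

theorem discMobius_mem_disc {a z : ℂ} (ha : ‖a‖ < 1) (hz : z ∈ disc) : discMobius a z ∈ disc := by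
  have hz' : ‖z‖ < 1 := mem_ball_zero_iff.1 hz
  have h := sq_norm_one_sub_conj_mul_sub z (-a)
  rw [norm_neg, map_neg, neg_mul, sub_neg_eq_add, sub_neg_eq_add] at h
  have hpos := norm_pos_iff.2 (discMobius_denom_ne_zero ha.le hz')
  rw [mem_ball_zero_iff, discMobius, norm_div, div_lt_one hpos]
  have ha2 : ‖a‖ ^ 2 < 1 := pow_lt_one₀ (norm_nonneg _) ha two_ne_zero
  have hz2 : ‖z‖ ^ 2 < 1 := pow_lt_one₀ (norm_nonneg _) hz' two_ne_zero
  have : 0 < (1 - ‖z‖ ^ 2) * (1 - ‖a‖ ^ 2) := mul_pos (by linarith) (by linarith)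
  exact lt_of_pow_lt_pow_left₀ 2 hpos.le (by linarith)

theorem discMobius_neg_apply {a z : ℂ} (ha : ‖a‖ < 1) (hz : z ∈ disc) :
    discMobius (-a) (discMobius a z) = z := by
  have h1 := discMobius_denom_ne_zero ha.le (mem_ball_zero_iff.1 hz)
  have h2 := discMobius_denom_ne_zero (a := -a) (by simpa using ha.le)
    (mem_ball_zero_iff.1 (discMobius_mem_disc ha hz))
  have h3 := one_sub_conj_mul_self_ne_zero ha
  rw [discMobius, div_eq_iff h2, discMobius]
  rw [map_neg]
  clear h2 h3
  generalize conj a = b at *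
  rw [← sub_eq_zero]
  have : 1 + z * b ≠ 0 := by rwa [mul_comm]
  field_simp
  ring

theorem bijOn_discMobius {a : ℂ} (ha : ‖a‖ < 1) : BijOn (discMobius a) disc disc := by
  have h := fun z (hz : z ∈ disc) => discMobius_neg_apply (a := -a) (by simpa using ha) hz
  simp only [neg_neg] at h
  exact InvOn.bijOn (f' := discMobius (-a)) ⟨fun z hz => discMobius_neg_apply ha hz, h⟩
    (fun z hz => discMobius_mem_disc ha hz)
    (fun z hz => discMobius_mem_disc (by simpa using ha) hz)

theorem hasDerivAt_discMobius {a z : ℂ} (ha : ‖a‖ < 1) (hz : z ∈ disc) :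
    HasDerivAt (discMobius a) ((1 - conj a * a) / (1 + conj a * z) ^ 2) z := by
  have h1 : HasDerivAt (fun w : ℂ => 1 + conj a * w) (conj a) z := by
    simpa using ((hasDerivAt_id z).const_mul (conj a)).const_add 1
  convert! ((hasDerivAt_id z).add_const a).div h1
    (discMobius_denom_ne_zero ha.le (mem_ball_zero_iff.1 hz)) using 1
  simp only [id]
  congr 1; ring

theorem discMobius_mem_discAut {a : ℂ} (ha : ‖a‖ < 1) : discMobius a ∈ discAut :=
  ⟨fun _ hz => (hasDerivAt_discMobius ha hz).differentiableAt.differentiableWithinAt,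
    bijOn_discMobius ha⟩

theorem measurable_discMobius (a : ℂ) : Measurable (discMobius a) := by
  unfold discMobius; fun_prop

/-- Every automorphism of the disc has, up to a rotation, a Möbius inverse. -/
theorem exists_norm_apply_discMobius_eq {φ : ℂ → ℂ} (hφ : φ ∈ discAut) :
    ∃ a : ℂ, ‖a‖ < 1 ∧ ∀ z ∈ disc, ‖φ (discMobius a z)‖ = ‖z‖ := by
  obtain ⟨a, ha, hφa⟩ := hφ.2.surjOn (show (0 : ℂ) ∈ disc by simp)
  have ha' : ‖a‖ < 1 := mem_ball_zero_iff.1 ha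
  refine ⟨a, ha', fun z hz => ?_⟩
  exact norm_apply_eq_of_bijOn (g := φ ∘ discMobius a)
    (hφ.1.comp (discMobius_mem_discAut ha').1 (bijOn_discMobius ha').mapsTo)
    (hφ.2.comp (bijOn_discMobius ha')) (by simpa [discMobius] using hφa) hz

/-- The quotient `ψ' / (1 - ψ)` for a disc automorphism `ψ`. -/
theorem deriv_discMobius_div_one_sub {a z : ℂ} (ha : ‖a‖ < 1) (hz : z ∈ disc) :
    (1 - conj a * a) / (1 + conj a * z) ^ 2 / (1 - discMobius a z) =
      ((1 - conj a) / (1 - a) - -conj a) /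
        ((1 - (1 - conj a) / (1 - a) * z) * (1 - -conj a * z)) := by
  have hz' := mem_ball_zero_iff.1 hz
  have h1 := discMobius_denom_ne_zero ha.le hz'
  have h2 : 1 - a ≠ 0 := by simpa using one_sub_mul_ne_zero (t := 1) (by simp) ha
  have h3 : 1 - discMobius a z ≠ 0 := by
    simpa using one_sub_mul_ne_zero (t := 1) (by simp)
      (mem_ball_zero_iff.1 (discMobius_mem_disc ha hz))
  have e : 1 - discMobius a z = ((1 - a) - (1 - conj a) * z) / (1 + conj a * z) := by
    rw [discMobius, eq_div_iff h1, sub_mul, div_mul_cancel₀ _ h1]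
    ring
  rw [e] at h3 ⊢
  have h4 : (1 - a) - (1 - conj a) * z ≠ 0 := fun h => h3 (by rw [h, zero_div])
  have e2 : 1 - (1 - conj a) / (1 - a) * z = ((1 - a) - (1 - conj a) * z) / (1 - a) := by
    field_simp
  rw [e2, neg_mul, sub_neg_eq_add, sub_neg_eq_add]
  generalize (1 - a) - (1 - conj a) * z = D at *
  generalize 1 + conj a * z = E at *
  field_simp
  ring

/-! ### Area integrals and radial weights -/

theorem lintegral_areaMeasure (F : ℂ → ℝ≥0∞) :
    ∫⁻ z, F z ∂areaMeasure = (ENNReal.ofReal Real.pi)⁻¹ * ∫⁻ z in disc, F z := by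
  rw [areaMeasure, lintegral_smul_measure, smul_eq_mul]

/-- Change of variables under an analytic bijection of the disc. -/
theorem lintegral_areaMeasure_comp {ψ ψ' : ℂ → ℂ} (hψ : ∀ z ∈ disc, HasDerivAt ψ (ψ' z) z)
    (hb : BijOn ψ disc disc) (F : ℂ → ℝ≥0∞) :
    ∫⁻ w, F w ∂areaMeasure = ∫⁻ z, ‖ψ' z‖ₑ ^ 2 * F (ψ z) ∂areaMeasure := by
  rw [lintegral_areaMeasure, lintegral_areaMeasure]
  congr 1
  have h := lintegral_image_eq_lintegral_abs_det_fderiv_mul volume (s := disc) (f := ψ)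
    (f' := fun z => ((ContinuousLinearMap.toSpanSingleton ℂ (ψ' z)).restrictScalars ℝ))
    measurableSet_ball
    (fun z hz => ((hψ z hz).hasFDerivAt.restrictScalars ℝ).hasFDerivWithinAt) hb.injOn F
  rw [hb.image_eq] at h
  rw [h]
  refine setLIntegral_congr_fun measurableSet_ball fun z _ => ?_
  congr 1
  -- The real Jacobian of multiplication by `ψ' z` is the norm of `ψ' z` from `ℂ` to `ℝ`.
  have hdet : ((ContinuousLinearMap.toSpanSingleton ℂ (ψ' z)).restrictScalars ℝ).det =
      ‖ψ' z‖ ^ 2 := by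
    rw [ContinuousLinearMap.det, ContinuousLinearMap.coe_restrictScalars,
      LinearMap.det_restrictScalars, Algebra.norm_complex_apply, Complex.normSq_eq_norm_sq]
    congr 2
    simp
  rw [hdet, abs_of_nonneg (by positivity), ENNReal.ofReal_pow (norm_nonneg _), ofReal_norm]

theorem lintegral_areaMeasure_congr {F G : ℂ → ℝ≥0∞} (h : ∀ z ∈ disc, F z = G z) :
    ∫⁻ z, F z ∂areaMeasure = ∫⁻ z, G z ∂areaMeasure := by
  rw [lintegral_areaMeasure, lintegral_areaMeasure, setLIntegral_congr_fun measurableSet_ball h]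

theorem lintegral_areaMeasure_mono {F G : ℂ → ℝ≥0∞} (h : ∀ z ∈ disc, F z ≤ G z) :
    ∫⁻ z, F z ∂areaMeasure ≤ ∫⁻ z, G z ∂areaMeasure := by
  rw [lintegral_areaMeasure, lintegral_areaMeasure]
  gcongr 1
  exact setLIntegral_mono' measurableSet_ball h

theorem lintegral_areaMeasure_rotate {c : ℂ} (hc : ‖c‖ = 1) (F : ℂ → ℝ≥0∞) :
    ∫⁻ z, F (c * z) ∂areaMeasure = ∫⁻ z, F z ∂areaMeasure := by
  have hc0 : c ≠ 0 := norm_ne_zero_iff.1 (by simp [hc])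
  have hb : BijOn (fun z => c * z) disc disc := by
    refine InvOn.bijOn (f' := fun z => c⁻¹ * z) ⟨fun z _ => ?_, fun z _ => ?_⟩
      (fun z hz => ?_) (fun z hz => ?_)
    · simp [hc0]
    · simp [hc0]
    · simpa [hc] using hz
    · simpa [hc] using hz
  rw [lintegral_areaMeasure_comp (ψ := fun z => c * z) (ψ' := fun _ => c) (fun z _ => by
    simpa using (hasDerivAt_id z).const_mul c) hb F]
  simp [← ofReal_norm, hc]

/-- The area measure and `U` are rotation invariant, so every rotate of `F` has the same weighted
integral; Tonelli then averages over the angle. -/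
theorem lintegral_areaMeasure_mul_eq_average {F U : ℂ → ℝ≥0∞} (hF : Measurable F)
    (hU : Measurable U) (hUr : ∀ c z : ℂ, ‖c‖ = 1 → U (c * z) = U z) :
    (∫⁻ z, F z * U z ∂areaMeasure) * ENNReal.ofReal (2 * Real.pi) =
      ∫⁻ z, (∫⁻ θ in Ioc (0 : ℝ) (2 * Real.pi), F (circleMap 0 1 θ * z)) * U z ∂areaMeasure := by
  have : SFinite areaMeasure := by unfold areaMeasure; infer_instance
  have hcm : Measurable (circleMap 0 1) := (continuous_circleMap 0 1).measurable
  have h1 : ∀ z, (∫⁻ θ in Ioc (0 : ℝ) (2 * Real.pi), F (circleMap 0 1 θ * z)) * U z =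
      ∫⁻ θ in Ioc (0 : ℝ) (2 * Real.pi), F (circleMap 0 1 θ * z) * U z := fun z =>
    (lintegral_mul_const _ (hF.comp (hcm.mul_const z))).symm
  simp only [h1]
  rw [lintegral_lintegral_swap]
  · have h2 : ∀ θ : ℝ, ∫⁻ z, F (circleMap 0 1 θ * z) * U z ∂areaMeasure =
        ∫⁻ z, F z * U z ∂areaMeasure := by
      intro θ
      have hc : ‖circleMap 0 1 θ‖ = 1 := by simp
      rw [← lintegral_areaMeasure_rotate hc fun z => F z * U z]
      simp only [hUr _ _ hc]
    simp only [h2]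
    simp
  · refine Measurable.aemeasurable ?_
    have : Measurable fun p : ℂ × ℝ => circleMap 0 1 p.2 * p.1 :=
      (hcm.comp measurable_snd).mul measurable_fst
    exact (hF.comp this).mul (hU.comp measurable_fst)

/-- Integrals against a radial weight are compared by comparing averages over circles. -/
theorem lintegral_areaMeasure_mul_le_of_average_le {F G U : ℂ → ℝ≥0∞} (hF : Measurable F)
    (hG : Measurable G) (hU : Measurable U) (hUr : ∀ c z : ℂ, ‖c‖ = 1 → U (c * z) = U z)
    (h : ∀ z ∈ disc, ∫⁻ θ in Ioc (0 : ℝ) (2 * Real.pi), F (circleMap 0 1 θ * z) ≤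
      ∫⁻ θ in Ioc (0 : ℝ) (2 * Real.pi), G (circleMap 0 1 θ * z)) :
    ∫⁻ z, F z * U z ∂areaMeasure ≤ ∫⁻ z, G z * U z ∂areaMeasure := by
  have hpi : ENNReal.ofReal (2 * Real.pi) ≠ 0 := by simp [Real.pi_pos]
  rw [← ENNReal.mul_le_mul_iff_left hpi ENNReal.ofReal_ne_top,
    lintegral_areaMeasure_mul_eq_average hF hU hUr, lintegral_areaMeasure_mul_eq_average hG hU hUr]
  refine lintegral_areaMeasure_mono fun z hz => ?_
  exact mul_le_mul_left (h z hz) _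

theorem lintegral_enorm_sq_circle {k : ℂ → ℂ} (hk : ContinuousOn k disc) {z : ℂ} (hz : z ∈ disc) :
    ∫⁻ θ in Ioc (0 : ℝ) (2 * Real.pi), ‖k (circleMap 0 1 θ * z)‖ₑ ^ 2 =
      ENNReal.ofReal (∫ θ in (0 : ℝ)..2 * Real.pi, ‖k (circleMap 0 1 θ * z)‖ ^ 2) := by
  have hc : Continuous fun θ : ℝ => ‖k (circleMap 0 1 θ * z)‖ ^ 2 :=
    ((hk.comp_continuous ((continuous_circleMap 0 1).mul_const z)
      fun θ => by simpa using hz).norm).pow 2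
  rw [intervalIntegral.integral_of_le (by positivity),
    ofReal_integral_eq_lintegral_ofReal ((hc.integrableOn_Icc).mono_set Ioc_subset_Icc_self)
      (Eventually.of_forall fun θ => by positivity)]
  refine lintegral_congr fun θ => ?_
  rw [ENNReal.ofReal_pow (norm_nonneg _), ofReal_norm]

theorem one_sub_sq_ne_zero {z : ℂ} (hz : ‖z‖ < 1) : 1 - z ^ 2 ≠ 0 := by
  rw [sq]; exact one_sub_mul_ne_zero hz.le hz

theorem lintegral_kernel_mul_le {l d : ℂ} (hl : ‖l‖ = 1) (hd : ‖d‖ ≤ 1) {U : ℂ → ℝ≥0∞}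
    (hU : Measurable U) (hUr : ∀ c z : ℂ, ‖c‖ = 1 → U (c * z) = U z) :
    ∫⁻ z, ‖(l - d) / ((1 - l * z) * (1 - d * z))‖ₑ ^ 2 * U z ∂areaMeasure ≤
      ∫⁻ z, ‖2 / (1 - z ^ 2)‖ₑ ^ 2 * U z ∂areaMeasure := by
  refine lintegral_areaMeasure_mul_le_of_average_le (by fun_prop) (by fun_prop) hU hUr
    fun z hz => ?_
  have h1 : ContinuousOn (fun z => (l - d) / ((1 - l * z) * (1 - d * z))) disc :=
    ContinuousOn.div (by fun_prop) (by fun_prop) fun w hw => by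
      have hw' := mem_ball_zero_iff.1 hw
      exact mul_ne_zero (one_sub_mul_ne_zero hl.le hw') (one_sub_mul_ne_zero hd hw')
  have h2 : ContinuousOn (fun z : ℂ => 2 / (1 - z ^ 2)) disc :=
    ContinuousOn.div (by fun_prop) (by fun_prop) fun w hw =>
      one_sub_sq_ne_zero (mem_ball_zero_iff.1 hw)
  rw [lintegral_enorm_sq_circle h1 hz, lintegral_enorm_sq_circle h2 hz]
  exact ENNReal.ofReal_le_ofReal (integral_sq_norm_kernel_le hl hd (mem_ball_zero_iff.1 hz))

/-! ### The upper bound for each automorphism -/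

theorem norm_le_of_hInfNorm_le_one {f : ℂ → ℂ} (hf : hInfNorm f ≤ 1) {z : ℂ} (hz : z ∈ disc) :
    ‖f z‖ ≤ 1 := by
  have h : ‖f z‖ₑ ≤ 1 := (le_iSup₂ (f := fun z (_ : z ∈ disc) => ‖f z‖ₑ) z hz).trans hf
  rwa [← ofReal_norm, ENNReal.ofReal_le_one] at h

theorem lintegral_deriv_hilbertOp_le {μ : Measure ℂ} [SFinite (μ.restrict disc)] (hμ : IsRadial μ)
    {f : ℂ → ℂ} (hf : DifferentiableOn ℂ f disc) (hM : ∀ z ∈ disc, ‖f z‖ ≤ 1) {φ : ℂ → ℂ}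
    (hφ : φ ∈ discAut) :
    ∫⁻ w, ‖deriv (hilbertOp f) w‖ₑ ^ 2 * potential μ (φ w) ∂areaMeasure ≤
      ∫⁻ z, ‖2 / (1 - z ^ 2)‖ₑ ^ 2 * potential μ z ∂areaMeasure := by
  obtain ⟨a, ha, hφa⟩ := exists_norm_apply_discMobius_eq hφ
  -- The numerator is the conjugate of the denominator.
  have h1a : ‖(1 - conj a) / (1 - a)‖ = 1 := by
    have hne : 1 - a ≠ 0 := by simpa using one_sub_mul_ne_zero (t := 1) (by simp) ha
    rw [norm_div, ← RCLike.norm_conj, map_sub, map_one, Complex.conj_conj,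
      div_self (norm_ne_zero_iff.2 hne)]
  calc _ ≤ ∫⁻ w, ‖1 / (1 - w)‖ₑ ^ 2 * potential μ (φ w) ∂areaMeasure := by
        refine lintegral_areaMeasure_mono fun w hw => ?_
        gcongr
        rw [← ofReal_norm, ← ofReal_norm, norm_div, norm_one]
        exact ENNReal.ofReal_le_ofReal (norm_deriv_hilbertOp_le hf hM hw)
    _ = ∫⁻ z, ‖((1 - conj a) / (1 - a) - -conj a) /
        ((1 - (1 - conj a) / (1 - a) * z) * (1 - -conj a * z))‖ₑ ^ 2 *
          potential μ z ∂areaMeasure := by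
        rw [lintegral_areaMeasure_comp (fun z hz => hasDerivAt_discMobius ha hz)
          (bijOn_discMobius ha)]
        refine lintegral_areaMeasure_congr fun z hz => ?_
        rw [potential_eq_of_norm_eq hμ (hφa z hz), ← mul_assoc, ← mul_pow, ← enorm_mul,
          mul_one_div, deriv_discMobius_div_one_sub ha hz]
    _ ≤ _ := lintegral_kernel_mul_le h1a (by simpa using ha.le) measurable_potential
        fun c z hc => potential_mul hμ hc z

/-! ### The lower bound from the constant function -/

theorem tendsto_discMobius_one {z : ℂ} (hz : z ∈ disc) {r : ℕ → ℝ} (hr : Tendsto r atTop (𝓝 1))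
    (hr1 : ∀ n, ‖(r n : ℂ)‖ < 1) :
    Tendsto (fun n => discMobius (r n) z) atTop (𝓝[disc] 1) := by
  refine tendsto_nhdsWithin_iff.2 ⟨?_, Eventually.of_forall fun n => discMobius_mem_disc (hr1 n) hz⟩
  have hne : (1 : ℂ) + z ≠ 0 := by
    simpa using discMobius_denom_ne_zero (a := 1) (by simp) (mem_ball_zero_iff.1 hz)
  have hc : ContinuousAt (fun x : ℝ => (z + x) / (1 + x * z)) 1 :=
    ContinuousAt.div (by fun_prop) (by fun_prop) (by simpa using hne)
  have := hc.tendsto.comp hr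
  simp only [Complex.ofReal_one, one_mul, add_comm z 1, div_self hne] at this
  simpa [discMobius, Function.comp_def, add_comm] using this

/-- The extremal growth is attained along the automorphisms that push the disc to `1`. -/
theorem lintegral_le_iSup_discAut {μ : Measure ℂ} [SFinite (μ.restrict disc)] :
    ∫⁻ z, ‖2 / (1 - z ^ 2)‖ₑ ^ 2 * potential μ z ∂areaMeasure ≤
      ⨆ φ ∈ discAut,
        ∫⁻ w, ‖deriv (hilbertOp 1) w‖ₑ ^ 2 * potential μ (φ w) ∂areaMeasure := by
  set S := ⨆ φ ∈ discAut,
    ∫⁻ w, ‖deriv (hilbertOp 1) w‖ₑ ^ 2 * potential μ (φ w) ∂areaMeasure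
  set r : ℕ → ℝ := fun n => 1 - 1 / ((n : ℝ) + 1) with hrdef
  have hr : Tendsto r atTop (𝓝 1) := by
    simpa [hrdef] using (tendsto_one_div_add_atTop_nhds_zero_nat (𝕜 := ℝ)).const_sub (1 : ℝ)
  have hr1 : ∀ n, ‖(r n : ℂ)‖ < 1 := by
    intro n
    have h1 : 0 < 1 / ((n : ℝ) + 1) := by positivity
    have h2 : 1 / ((n : ℝ) + 1) ≤ 1 := by
      rw [div_le_one (by positivity)]; linarith [n.cast_nonneg (α := ℝ)]
    rw [Complex.norm_real, Real.norm_of_nonneg (by simp only [hrdef]; linarith)]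
    simp only [hrdef]; linarith
  -- The integrand for `φ = discMobius (-r n)` after substituting `w = discMobius (r n) z`: since `φ
  -- w = z`, the potential no longer depends on `n`.
  set T : ℕ → ℂ → ℝ≥0∞ := fun n z => ‖(1 - conj (r n : ℂ) * r n) / (1 + conj (r n : ℂ) * z) ^ 2 *
    deriv (hilbertOp 1) (discMobius (r n) z)‖ₑ ^ 2 * potential μ z with hT
  have hTle : ∀ n, ∫⁻ z, T n z ∂areaMeasure ≤ S := by
    intro n
    have hneg : ‖-(r n : ℂ)‖ < 1 := by simpa using hr1 n
    refine le_iSup₂_of_le (discMobius (-(r n : ℂ))) (discMobius_mem_discAut hneg) (le_of_eq ?_)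
    symm
    rw [lintegral_areaMeasure_comp (fun z hz => hasDerivAt_discMobius (hr1 n) hz)
      (bijOn_discMobius (hr1 n))]
    refine lintegral_areaMeasure_congr fun z hz => ?_
    simp only [hT]
    rw [discMobius_neg_apply (hr1 n) hz, ← mul_assoc, ← mul_pow, ← enorm_mul]
  have hTm : ∀ n, Measurable (T n) := by
    intro n
    have := (measurable_deriv (hilbertOp 1)).comp (measurable_discMobius (r n))
    have hd : Measurable fun z => (1 - conj (r n : ℂ) * r n) / (1 + conj (r n : ℂ) * z) ^ 2 := by
      fun_prop
    exact ((hd.mul this).enorm.pow_const 2).mul measurable_potential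
  have hTlim : ∀ z ∈ disc, Tendsto (fun n => T n z) atTop
      (𝓝 (‖2 / (1 - z ^ 2)‖ₑ ^ 2 * potential μ z)) := by
    intro z hz
    have hz' := mem_ball_zero_iff.1 hz
    have hsq := one_sub_sq_ne_zero hz'
    have hK : Tendsto (fun n => (1 - conj (r n : ℂ)) / (1 - r n)) atTop (𝓝 1) := by
      refine tendsto_const_nhds.congr' (Eventually.of_forall fun n => ?_)
      have : 1 - (r n : ℂ) ≠ 0 := by
        simpa using one_sub_mul_ne_zero (t := 1) (by simp) (hr1 n)
      simp only [Complex.conj_ofReal, div_self this]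
    have hrc : Tendsto (fun n => -conj (r n : ℂ)) atTop (𝓝 (-1)) := by
      simp only [Complex.conj_ofReal]
      have := ((Complex.continuous_ofReal.tendsto 1).comp hr).neg
      simpa [Function.comp_def] using this
    have hQ : Tendsto (fun n => ((1 - conj (r n : ℂ)) / (1 - r n) - -conj (r n : ℂ)) /
        ((1 - (1 - conj (r n : ℂ)) / (1 - r n) * z) * (1 - -conj (r n : ℂ) * z))) atTop
        (𝓝 ((1 - (-1)) / ((1 - 1 * z) * (1 - (-1) * z)))) := by
      refine (hK.sub hrc).div (((hK.mul_const z).const_sub 1).mul ((hrc.mul_const z).const_sub 1)) ?_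
      convert hsq using 1
      ring
    have hlim := hQ.mul
      (tendsto_one_sub_mul_deriv_hilbertOp_one.comp (tendsto_discMobius_one hz hr hr1))
    have e : (1 - (-1)) / ((1 - 1 * z) * (1 - (-1) * z)) * 1 = 2 / (1 - z ^ 2) := by
      ring_nf
    rw [e] at hlim
    refine ENNReal.Tendsto.mul_const (((ENNReal.continuous_pow 2).tendsto _).comp
      ((continuous_enorm.tendsto _).comp (hlim.congr fun n => ?_))) (Or.inl ?_)
    · have h1 : 1 - discMobius (r n) z ≠ 0 := by
        simpa using one_sub_mul_ne_zero (t := 1) (by simp)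
          (mem_ball_zero_iff.1 (discMobius_mem_disc (hr1 n) hz))
      rw [← deriv_discMobius_div_one_sub (hr1 n) hz, Function.comp_apply, ← mul_assoc,
        div_mul_cancel₀ _ h1]
    -- The limit kernel is nonzero, so multiplication by the potential preserves the limit even
    -- where the potential is infinite.
    · simpa using hsq
  calc _ = ∫⁻ z, liminf (fun n => T n z) atTop ∂areaMeasure :=
        lintegral_areaMeasure_congr fun z hz => (hTlim z hz).liminf_eq.symm
    _ ≤ liminf (fun n => ∫⁻ z, T n z ∂areaMeasure) atTop := lintegral_liminf_le hTm
    _ ≤ liminf (fun _ : ℕ => S) atTop := liminf_le_liminf (Eventually.of_forall hTle)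
    _ = S := liminf_const S

/-! ### Finiteness of the potential and assembly -/

theorem id_mem_discAut : (fun z => z) ∈ discAut := ⟨differentiableOn_id, bijOn_id disc⟩

theorem one_mem_HInf : (1 : ℂ → ℂ) ∈ HInf ∧ hInfNorm 1 ≤ 1 := by
  have h : hInfNorm 1 ≤ 1 := iSup₂_le fun z _ => by simp
  exact ⟨⟨differentiableOn_const 1, h.trans_lt ENNReal.one_lt_top⟩, h⟩

/-- Otherwise the identity automorphism would give an infinite integral, because `(H1)'` has no
zeros in the disc close to `1`. One point of finite potential makes `μ` s-finite on the disc, as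
Tonelli requires. -/
theorem exists_potential_ne_top {μ : Measure ℂ} (h : mdNorm μ (hilbertOp 1) < ∞) :
    ∃ z ∈ disc, potential μ z ≠ ∞ := by
  by_contra! hcon
  have hne : ∀ᶠ z in 𝓝[disc] (1 : ℂ), deriv (hilbertOp 1) z ≠ 0 :=
    (tendsto_one_sub_mul_deriv_hilbertOp_one.eventually_ne one_ne_zero).mono
      fun z hz => right_ne_zero_of_mul hz
  obtain ⟨O, hO, h1O, hsub⟩ := mem_nhdsWithin.1 hne
  have hopen : IsOpen (O ∩ disc) := hO.inter Metric.isOpen_ball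
  have hnon : (O ∩ disc).Nonempty := by
    refine mem_closure_iff.1 ?_ O hO h1O
    rw [closure_ball _ one_ne_zero]; simp
  have htop : ∫⁻ w, ‖deriv (hilbertOp 1) w‖ₑ ^ 2 * potential μ w ∂areaMeasure = ∞ := by
    rw [lintegral_areaMeasure]
    have : ∫⁻ w in disc, ‖deriv (hilbertOp 1) w‖ₑ ^ 2 * potential μ w = ∞ := by
      refine top_unique ?_
      calc ∞ = ∫⁻ _ in O ∩ disc, ∞ := by
            rw [setLIntegral_const, ENNReal.top_mul (hopen.measure_pos volume hnon).ne']
        _ = ∫⁻ w in O ∩ disc, ‖deriv (hilbertOp 1) w‖ₑ ^ 2 * potential μ w := by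
            refine setLIntegral_congr_fun hopen.measurableSet fun w hw => ?_
            have hw' : deriv (hilbertOp 1) w ≠ 0 := hsub hw
            rw [hcon w hw.2, ENNReal.mul_top (by simpa using hw')]
        _ ≤ _ := lintegral_mono_set inter_subset_right
    rw [this, ENNReal.mul_top (by simp)]
  have hle : (∫⁻ w, ‖deriv (hilbertOp 1) w‖ₑ ^ 2 * potential μ w ∂areaMeasure) ^ (1 / 2 : ℝ) ≤
      mdNorm μ (hilbertOp 1) :=
    (le_iSup₂ (f := fun (φ : ℂ → ℂ) (_ : φ ∈ discAut) =>
      (∫⁻ w, ‖deriv (hilbertOp 1) w‖ₑ ^ 2 * potential μ (φ w) ∂areaMeasure) ^ (1 / 2 : ℝ))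
      (fun z => z) id_mem_discAut).trans le_add_self
  rw [htop, ENNReal.top_rpow_of_pos (by norm_num), top_le_iff] at hle
  exact h.ne hle

theorem enorm_two_div_sq (w : ℂ) : ‖2 / w‖ₑ ^ 2 = ENNReal.ofReal (4 / ‖w‖ ^ 2) := by
  rw [← ofReal_norm, ← ENNReal.ofReal_pow (norm_nonneg _), norm_div, div_pow]
  norm_num

theorem hilbertOpNorm_le {μ : Measure ℂ} [SFinite (μ.restrict disc)] (hμ : IsRadial μ) :
    hilbertOpNorm μ ≤
      1 + (∫⁻ z, ‖2 / (1 - z ^ 2)‖ₑ ^ 2 * potential μ z ∂areaMeasure) ^ (1 / 2 : ℝ) := by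
  refine iSup₂_le fun f hf => ?_
  have hM := fun z (hz : z ∈ disc) => norm_le_of_hInfNorm_le_one hf.2 hz
  refine add_le_add ?_ (iSup₂_le fun φ hφ => ENNReal.rpow_le_rpow
    (lintegral_deriv_hilbertOp_le hμ hf.1.1 hM hφ) (by norm_num))
  rw [← ofReal_norm, ENNReal.ofReal_le_one]
  exact norm_hilbertOp_zero_le hf.1.1 hM

theorem le_mdNorm_hilbertOp_one {μ : Measure ℂ} [SFinite (μ.restrict disc)] :
    1 + (∫⁻ z, ‖2 / (1 - z ^ 2)‖ₑ ^ 2 * potential μ z ∂areaMeasure) ^ (1 / 2 : ℝ) ≤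
      mdNorm μ (hilbertOp 1) := by
  unfold mdNorm
  rw [hilbertOp_one_zero, enorm_one]
  gcongr 1
  set X := ⨆ φ ∈ discAut,
    (∫⁻ w, ‖deriv (hilbertOp 1) w‖ₑ ^ 2 * potential μ (φ w) ∂areaMeasure) ^ (1 / 2 : ℝ) with hX
  -- Comparison with `X ^ 2` carries the square root past the supremum.
  have h : ∫⁻ z, ‖2 / (1 - z ^ 2)‖ₑ ^ 2 * potential μ z ∂areaMeasure ≤ X ^ (2 : ℝ) := by
    refine lintegral_le_iSup_discAut.trans (iSup₂_le fun φ hφ => ?_)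
    have := ENNReal.rpow_le_rpow (le_iSup₂ (f := fun (φ : ℂ → ℂ) (_ : φ ∈ discAut) =>
      (∫⁻ w, ‖deriv (hilbertOp 1) w‖ₑ ^ 2 * potential μ (φ w) ∂areaMeasure) ^ (1 / 2 : ℝ)) φ hφ)
      (zero_le_two (α := ℝ))
    rwa [← ENNReal.rpow_mul, one_div_mul_cancel two_ne_zero, ENNReal.rpow_one] at this
  refine (ENNReal.rpow_le_rpow h (by norm_num : (0 : ℝ) ≤ 1 / 2)).trans (le_of_eq ?_)
  rw [← ENNReal.rpow_mul, mul_one_div_cancel two_ne_zero, ENNReal.rpow_one]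

end HilbertMDmu

theorem theorem1p3 (μ : MeasureTheory.Measure ℂ)
    (hdisc : μ (HilbertMDmu.disc)ᶜ = 0)
    (hradial : HilbertMDmu.IsRadial μ)
    (hbdd : HilbertMDmu.HilbertBounded μ) :
    HilbertMDmu.hilbertOpNorm μ < ⊤ ∧
      HilbertMDmu.hilbertOpNorm μ =
        1 + (∫⁻ z, ENNReal.ofReal (4 / ‖1 - z ^ 2‖ ^ 2) * HilbertMDmu.potential μ z
          ∂HilbertMDmu.areaMeasure) ^ (1 / 2 : ℝ) := by
  obtain ⟨C, hC⟩ := hbdd.2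
  have hfin : HilbertMDmu.mdNorm μ (HilbertMDmu.hilbertOp 1) < ⊤ :=
    -- The constant function `1` serves twice: it supplies s-finiteness here and attains the norm
    -- below.
    (hbdd.1 1 HilbertMDmu.one_mem_HInf.1).2
  obtain ⟨z, hz, hpot⟩ := HilbertMDmu.exists_potential_ne_top hfin
  have := HilbertMDmu.sFinite_restrict_of_potential_ne_top hz hpot
  refine ⟨?_, ?_⟩
  · refine lt_of_le_of_lt (iSup₂_le fun f hf => (hC f hf.1).trans ?_) (ENNReal.coe_lt_top (r := C))
    exact mul_le_of_le_one_right' hf.2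
  · simp only [← HilbertMDmu.enorm_two_div_sq]
    exact le_antisymm (HilbertMDmu.hilbertOpNorm_le hradial)
      (HilbertMDmu.le_mdNorm_hilbertOp_one.trans
        (le_iSup₂ (f := fun (f : ℂ → ℂ) (_ : f ∈ {f | f ∈ HilbertMDmu.HInf ∧
          HilbertMDmu.hInfNorm f ≤ 1}) => HilbertMDmu.mdNorm μ (HilbertMDmu.hilbertOp f))
          1 HilbertMDmu.one_mem_HInf))
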